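/- Let $K$ be a number field with ring of integers $\mathcal O$ and archimedean completions $K_1,\dots,K_r$, $r\ge 2$. Put $G=\prod_{i=1}^r \mathrm{SL}(2,K_i)$, let $\Gamma=\mathrm{SL}(2,\mathcal O)$ be embedded diagonally in $G$, and let $\pi\colon G\to G/\Gamma$ be the projection. Let $D_i$ be the identity component of the diagonal subgroup of $\mathrm{SL}(2,K_i)$ and $D_{i,\mathbb R}$ the identity component of the group of real matrices in $D_i$; for $I\subset\{1,\dots,r\}$ put $D_I=\prod_{i\in I}D_i$ and $D_{I,\mathbb R}=\prod_{i\in I}D_{i,\mathbb R}$. A torus in $G$ is a subgroup conjugate to a closed connected subgroup of $D_{\{1,\dots,r\}}$. The orbit $D_I\pi(g)$ (respectively $D_{I,\mathbb R}\pi(g)$) is called locally divergent if for every $i\in I$ the orbit $D_i\pi(g)$ (respectively $D_{i,\mathbb R}\pi(g)$) is divergent, i.e. $h\pi(g)$ leaves every compact subset of $G/\Gamma$ as $h$ leaves the compact subsets of the group. A subset of $G/\Gamma$ is called homogeneous if it equals $Fx$ for some $x\in G/\Gamma$ and some closed subgroup $F$ of $G$ containing $D_{I,\mathbb R}$. A Borel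 measure $\mu$ on $G/\Gamma$ is called algebraic if there are a closed subgroup $F$ of $G$ containing $D_{I,\mathbb R}$ and a point $x\in G/\Gamma$ such that $\mu$ is $F$-invariant and $\operatorname{supp}(\mu)=Fx$. Theorem. Let $\#I=2$, let $T=D_I$ or $T=D_{I,\mathbb R}$, and let $g\in G$ be such that $T\pi(g)$ is locally divergent and its closure $\overline{T\pi(g)}$ is not an orbit of a torus. Then $\overline{T\pi(g)}=\operatorname{supp}(\mu)$ for some non-algebraic, $T$-invariant, $T$-ergodic, $\sigma$-finite Borel measure $\mu$ on $G/\Gamma$. Moreover, $\overline{T\pi(g)}$ is not homogeneous. -/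

import Mathlib

open NumberField MeasureTheory Topology Filter

namespace HilbertModular

/-! ### The group `G`, the lattice `Γ` and the Hilbert modular space `G/Γ`

The index set `{1, …, r}` is the finite type `InfinitePlace K` of archimedean places of `K`, and
`K_i` is the completion `v.Completion`. -/

/-- `G = ∏ᵥ SL(2, K_v)`, the product over all archimedean places of `K`, with the product
topology. -/
abbrev G (K : Type*) [Field K] [NumberField K] : Type _ :=
  ∀ v : InfinitePlace K, Matrix.SpecialLinearGroup (Fin 2) v.Completion

/-- The diagonal embedding `SL(2, 𝓞_K) → G`. -/
noncomputable def diagEmb (K : Type*) [Field K] [NumberField K] :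
    Matrix.SpecialLinearGroup (Fin 2) (𝓞 K) →* G K :=
  MonoidHom.mk' (fun γ v => Matrix.SpecialLinearGroup.map
      ((algebraMap K v.Completion).comp (algebraMap (𝓞 K) K)) γ)
    (fun γ δ => funext fun _ => map_mul _ γ δ)

/-- `Γ = SL(2, 𝓞_K)`, diagonally embedded in `G`. -/
noncomputable def Γ (K : Type*) [Field K] [NumberField K] : Subgroup (G K) :=
  (diagEmb K).range

/-- The Hilbert modular space `G/Γ`, with the quotient topology and the left action of `G`. -/
abbrev Space (K : Type*) [Field K] [NumberField K] : Type _ := G K ⧸ Γ K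

/-- `G/Γ` carries its Borel `σ`-algebra. -/
noncomputable instance instMeasurableSpaceSpace (K : Type*) [Field K] [NumberField K] :
    MeasurableSpace (Space K) := borel (Space K)

instance instBorelSpaceSpace (K : Type*) [Field K] [NumberField K] :
    BorelSpace (Space K) := ⟨rfl⟩

/-- The projection `π : G → G/Γ`. -/
noncomputable def π {K : Type*} [Field K] [NumberField K] (g : G K) : Space K := QuotientGroup.mk g

/-! ### Diagonal subgroups -/

/-- `d_v : K_vˣ → SL(2, K_v)`, `x ↦ diag(x, x⁻¹)`. -/
noncomputable def d {K : Type*} [Field K] (v : InfinitePlace K) :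
    v.Completionˣ →* Matrix.SpecialLinearGroup (Fin 2) v.Completion where
  toFun x := ⟨!![(x : v.Completion), 0; 0, ((x⁻¹ : v.Completionˣ) : v.Completion)], by
    simp [Matrix.det_fin_two]⟩
  map_one' := by
    ext i j
    fin_cases i <;> fin_cases j <;> simp
  map_mul' x y := by
    apply Subtype.ext
    change !![((x * y : v.Completionˣ) : v.Completion), 0; 0,
        (((x * y)⁻¹ : v.Completionˣ) : v.Completion)] =
      !![(x : v.Completion), 0; 0, ((x⁻¹ : v.Completionˣ) : v.Completion)] *
        !![(y : v.Completion), 0; 0, ((y⁻¹ : v.Completionˣ) : v.Completion)]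
    rw [Matrix.mul_fin_two]
    simp [mul_comm]

/-- The identity component of `K_vˣ`: the positive elements if `K_v = ℝ`, and all of `K_vˣ` if
`K_v = ℂ`. -/
noncomputable def unitsComponent {K : Type*} [Field K] (v : InfinitePlace K) :
    Subgroup v.Completionˣ where
  carrier := {x | ∀ hv : v.IsReal,
    0 < InfinitePlace.Completion.extensionEmbeddingOfIsReal hv (x : v.Completion)}
  mul_mem' := by
    intro x y hx hy hv
    rw [Units.val_mul, map_mul]
    exact mul_pos (hx hv) (hy hv)
  one_mem' := by
    intro hv
    rw [Units.val_one, map_one]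
    exact one_pos
  inv_mem' := by
    intro x hx hv
    rw [Units.val_inv_eq_inv_val, map_inv₀]
    exact inv_pos.2 (hx hv)

/-- The positive real elements of `K_vˣ`. For complex `v` the identification `K_v ≅ ℂ` is unique up
to complex conjugation, so being real does not depend on it. -/
noncomputable def posRealUnits {K : Type*} [Field K] (v : InfinitePlace K) :
    Subgroup v.Completionˣ where
  carrier := {x | ∃ a : ℝ, 0 < a ∧
    InfinitePlace.Completion.extensionEmbedding v (x : v.Completion) = (a : ℂ)}
  mul_mem' := by
    rintro x y ⟨a, ha, hxa⟩ ⟨b, hb, hyb⟩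
    exact ⟨a * b, mul_pos ha hb, by rw [Units.val_mul, map_mul, hxa, hyb, Complex.ofReal_mul]⟩
  one_mem' := ⟨1, one_pos, by rw [Units.val_one, map_one, Complex.ofReal_one]⟩
  inv_mem' := by
    rintro x ⟨a, ha, hxa⟩
    exact ⟨a⁻¹, inv_pos.2 ha, by
      rw [Units.val_inv_eq_inv_val, map_inv₀, hxa, Complex.ofReal_inv]⟩

/-- For a family of subgroups `S_v ≤ K_vˣ`, the subgroup `∏_{v ∈ I} d_v(S_v)` of `G` (with trivial
component at every `v ∉ I`). -/
noncomputable def diagProd {K : Type*} [Field K] [NumberField K]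
    (S : ∀ v : InfinitePlace K, Subgroup v.Completionˣ) (I : Finset (InfinitePlace K)) :
    Subgroup (G K) where
  carrier := {g | ∀ v, (v ∈ I → g v ∈ (S v).map (d v)) ∧ (v ∉ I → g v = 1)}
  mul_mem' := by
    intro g h hg hh v
    refine ⟨fun hv => mul_mem ((hg v).1 hv) ((hh v).1 hv), fun hv => ?_⟩
    rw [Pi.mul_apply, (hg v).2 hv, (hh v).2 hv, one_mul]
  one_mem' := fun _ => ⟨fun _ => one_mem _, fun _ => rfl⟩
  inv_mem' := by
    intro g hg v
    refine ⟨fun hv => inv_mem ((hg v).1 hv), fun hv => ?_⟩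
    rw [Pi.inv_apply, (hg v).2 hv, inv_one]

/-- `D_I = ∏_{v ∈ I} D_v`, where `D_v` is the identity component of the diagonal subgroup of
`SL(2, K_v)`. -/
noncomputable def D {K : Type*} [Field K] [NumberField K] (I : Finset (InfinitePlace K)) :
    Subgroup (G K) :=
  diagProd unitsComponent I

/-- `D_{I,ℝ} = ∏_{v ∈ I} D_{v,ℝ}`, where `D_{v,ℝ}` is the identity component of the group of real
matrices in `D_v`. -/
noncomputable def DR {K : Type*} [Field K] [NumberField K] (I : Finset (InfinitePlace K)) :
    Subgroup (G K) :=
  diagProd posRealUnits I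

/-- A torus in `G`: a subgroup conjugate to a closed connected subgroup of `D` (the group `D_I` for
`I` the set of all archimedean places). -/
def IsTorus {K : Type*} [Field K] [NumberField K] (S : Subgroup (G K)) : Prop :=
  ∃ (S₀ : Subgroup (G K)) (g : G K), S₀ ≤ D Finset.univ ∧ IsClosed (S₀ : Set (G K)) ∧
    IsConnected (S₀ : Set (G K)) ∧ S = S₀.map (MulAut.conj g).toMonoidHom

/-! ### Orbits and measures on `G/Γ` -/

/-- The orbit `H x` is divergent: `h x` leaves compact subsets of `G/Γ` when `h` leaves compact
subsets of `H`. -/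
def IsDivergent {K : Type*} [Field K] [NumberField K] (H : Subgroup (G K)) (x : Space K) : Prop :=
  Tendsto (fun h : H => h • x) (cocompact H) (cocompact (Space K))

/-- `X` is an orbit of a torus. -/
def IsTorusOrbit {K : Type*} [Field K] [NumberField K] (X : Set (Space K)) : Prop :=
  ∃ (S : Subgroup (G K)) (y : Space K), IsTorus S ∧ X = MulAction.orbit S y

/-- `X` is homogeneous (relative to `I`): `X = F y` for a closed subgroup `F` of `G` that contains
`D_{I,ℝ}`. -/
def IsHomogeneous {K : Type*} [Field K] [NumberField K] (I : Finset (InfinitePlace K))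
    (X : Set (Space K)) : Prop :=
  ∃ (F : Subgroup (G K)) (y : Space K), IsClosed (F : Set (G K)) ∧ DR I ≤ F ∧
    X = MulAction.orbit F y

/-- `μ` is algebraic (relative to `I`): there is a closed subgroup `F` of `G` that contains
`D_{I,ℝ}`, such that `μ` is `F`-invariant and `supp μ` is an orbit of `F`. -/
def IsAlgebraic {K : Type*} [Field K] [NumberField K] (I : Finset (InfinitePlace K))
    (μ : Measure (Space K)) : Prop :=
  ∃ (F : Subgroup (G K)) (y : Space K), IsClosed (F : Set (G K)) ∧ DR I ≤ F ∧
    SMulInvariantMeasure F (Space K) μ ∧ μ.support = MulAction.orbit F y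

end HilbertModular

/-!
The proof determines the closure of `T π(g)` well enough to exclude that it is homogeneous, and then
puts on the orbit the measure that it carries as a quotient of a vector group.

*Local divergence is a rationality condition.* By Mahler's criterion
(`exists_isCompact_forall_notMem`), divergence of `D_{v,ℝ} π(g)` produces arbitrarily short vectors
in the lattices `t g 𝓞_K²` as `t` goes to infinity in either direction. Short vectors at the same
time are proportional, so that a single line of `K²` carries all of them, and a row of `g_v`
annihilates this line. Hence both rows of `g_v` are multiples of integral rows
(`exists_vec_eq_zero_of_isDivergent`, `RationalRows`).

*The closure consists of finitely many diagonal pieces.* Let `t_n g γ_n → z`, where `t_n` lives at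
the two places `v₁`, `v₂`. The norm of a nonzero integer is at least `1`, so that an integral row
`r γ_n` cannot tend to zero at one place and stay bounded at the others; therefore, after passing
to a subsequence, `t_n` is bounded at both places or diverges at both. In the first case `γ_n` takes finitely many values. In the second,
let `r₁`, `r₂` be the integral rows expanded at `v₁` and at `v₂`. The factors that rescale `r₁ γ_n`
and `r₂ γ_n` to convergent sequences are inverse to each other, so their norms are bounded from
above and below, and the determinant of `r_i γ_n` and `r_i γ_m` has norm smaller than `1`, hence
vanishes. So the directions of `r₁ γ_n` and `r₂ γ_n` are eventually constant, and they determine the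
rows of `z` up to scalars (`exists_eq_of_approach`). So the closure lies in the image of finitely
many sets `M_i A h_i Γ`, where `A` is the full diagonal group (`exists_closure_orbit_subset`).

*A homogeneous closure is a torus orbit.* If the closure `S` is an orbit of some subgroup, it is an
orbit of its stabilizer `F`, a closed subgroup. By Baire's theorem, `F` lies in one of the
conjugates `M_i A M_i⁻¹` near the identity. A closed subgroup of a vector space agrees with a linear
subspace near zero (`eventually_mem_lieSubspace`), and so `F` has an open subgroup `U` that is a
torus. The connected group `T` lies in `U`. By the open mapping theorem for group actions, the orbit
of the open subgroup `U` is closed in the closed orbit of `F`; it contains `T π(g)`, hence is all of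
`S` (`isTorusOrbit_closure_of_eq_orbit`).

*The measure.* `T` is a quotient of a real vector space `V`, and `T π(g)` is the injective
continuous image of `V` modulo a closed subgroup. The image of the Haar measure of this quotient is
`σ`-finite, `T`-invariant and ergodic, and its support is the closure of the orbit
(`exists_ergodic_support_eq_closure_orbit`). It is not algebraic because its support is not
homogeneous.
-/

namespace HilbertModular

/-! ### Completions and the topology of `G` and `G/Γ` -/

section

variable {K : Type*} [Field K]

instance properSpace_completion (v : InfinitePlace K) : ProperSpace v.Completion :=
  (InfinitePlace.Completion.isometry_extensionEmbedding v).isClosedEmbedding.isProperMap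
    |> fun h => ⟨fun x r => by
      have : Metric.closedBall x r ⊆ InfinitePlace.Completion.extensionEmbedding v ⁻¹'
          Metric.closedBall (InfinitePlace.Completion.extensionEmbedding v x) r := fun y hy => by
        simpa [(InfinitePlace.Completion.isometry_extensionEmbedding v).dist_eq] using hy
      exact (h.isCompact_preimage (isCompact_closedBall _ r)).of_isClosed_subset
        Metric.isClosed_closedBall this⟩

/-- The embedding `𝓞_K → K_v`. -/
noncomputable abbrev emb (v : InfinitePlace K) : 𝓞 K →+* v.Completion :=
  (algebraMap K v.Completion).comp (algebraMap (𝓞 K) K)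

theorem norm_algebraMap_completion (v : InfinitePlace K) (x : K) :
    ‖algebraMap K v.Completion x‖ = v x :=
  InfinitePlace.Completion.norm_coe v ((WithAbs.equiv v.1).symm x)

theorem norm_emb (v : InfinitePlace K) (x : 𝓞 K) : ‖emb v x‖ = v (x : K) :=
  norm_algebraMap_completion v x

theorem emb_injective (v : InfinitePlace K) : Function.Injective (emb v) :=
  (algebraMap K v.Completion).injective.comp RingOfIntegers.coe_injective

theorem emb_ne_zero (v : InfinitePlace K) {x : 𝓞 K} (hx : x ≠ 0) : emb v x ≠ 0 :=
  (map_ne_zero_iff _ (emb_injective v)).2 hx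

section Topology

variable {F : Type*} [NormedField F]

theorem isClosedEmbedding_coe_specialLinearGroup :
    IsClosedEmbedding
      (fun g : Matrix.SpecialLinearGroup (Fin 2) F => (g : Matrix (Fin 2) (Fin 2) F)) :=
  IsClosed.isClosedEmbedding_subtypeVal
    (isClosed_eq (Continuous.matrix_det continuous_id) continuous_const)

instance locallyCompactSpace_specialLinearGroup [ProperSpace F] :
    LocallyCompactSpace (Matrix.SpecialLinearGroup (Fin 2) F) :=
  haveI : LocallyCompactSpace (Matrix (Fin 2) (Fin 2) F) :=
    inferInstanceAs (LocallyCompactSpace (Fin 2 → Fin 2 → F))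
  isClosedEmbedding_coe_specialLinearGroup.locallyCompactSpace

instance secondCountableTopology_specialLinearGroup [ProperSpace F] :
    SecondCountableTopology (Matrix.SpecialLinearGroup (Fin 2) F) :=
  haveI : SecondCountableTopology F := secondCountable_of_proper
  haveI : SecondCountableTopology (Matrix (Fin 2) (Fin 2) F) :=
    inferInstanceAs (SecondCountableTopology (Fin 2 → Fin 2 → F))
  isClosedEmbedding_coe_specialLinearGroup.isEmbedding.secondCountableTopology

theorem isCompact_specialLinearGroup_norm_le [ProperSpace F] (R : ℝ) :
    IsCompact {g : Matrix.SpecialLinearGroup (Fin 2) F | ∀ i j, ‖g i j‖ ≤ R} := by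
  have h : IsCompact {m : Matrix (Fin 2) (Fin 2) F | ∀ i j, m i j ∈ Metric.closedBall (0 : F) R} :=
    (isCompact_closedBall (0 : F) R).matrix
  refine (isClosedEmbedding_coe_specialLinearGroup.isCompact_preimage h).of_isClosed_subset ?_ ?_
  · simp only [Set.ofPred_forall]
    exact isClosed_iInter fun i => isClosed_iInter fun j => isClosed_le
      (continuous_subtype_val.matrix_elem i j).norm
      continuous_const
  · intro g hg i j
    simpa using hg i j

end Topology

variable [NumberField K]

theorem continuous_entry (v : InfinitePlace K) (i j : Fin 2) :
    Continuous fun g : G K => g v i j :=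
  (continuous_subtype_val.comp (continuous_apply v)).matrix_elem i j

theorem isCompact_norm_le (R : ℝ) : IsCompact {g : G K | ∀ v i j, ‖g v i j‖ ≤ R} := by
  have : {g : G K | ∀ v i j, ‖g v i j‖ ≤ R} = Set.univ.pi fun v : InfinitePlace K =>
      {g : Matrix.SpecialLinearGroup (Fin 2) v.Completion | ∀ i j, ‖g i j‖ ≤ R} := by
    ext g; simp
  rw [this]
  exact isCompact_univ_pi fun v => isCompact_specialLinearGroup_norm_le R

instance locallyCompactSpace_G : LocallyCompactSpace (G K) := Pi.locallyCompactSpace_of_finite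

instance secondCountableTopology_G : SecondCountableTopology (G K) :=
  inferInstanceAs (SecondCountableTopology
    (∀ v : InfinitePlace K, Matrix.SpecialLinearGroup (Fin 2) v.Completion))

/-! ### Integers of bounded size -/

theorem one_le_prod_norm_emb {x : 𝓞 K} (hx : x ≠ 0) :
    1 ≤ ∏ v : InfinitePlace K, ‖emb v x‖ ^ v.mult := by
  simp only [norm_emb]
  rw [InfinitePlace.prod_eq_abs_norm, ← Algebra.coe_norm_int]
  have : Algebra.norm ℤ x ≠ 0 := Algebra.norm_ne_zero_iff.2 hx
  exact_mod_cast Int.one_le_abs this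

/-- An algebraic integer all of whose absolute values are smaller than `1` is zero. -/
theorem eq_zero_of_norm_emb_lt_one {x : 𝓞 K} (hx : ∀ v : InfinitePlace K, ‖emb v x‖ < 1) :
    x = 0 := by
  by_contra h
  obtain ⟨v₀⟩ := (inferInstance : Nonempty (InfinitePlace K))
  refine absurd (one_le_prod_norm_emb h) (not_le.2 ?_)
  calc ∏ v : InfinitePlace K, ‖emb v x‖ ^ v.mult
      < ∏ v : InfinitePlace K, (1 : ℝ) :=
        Finset.prod_lt_prod_of_nonempty
          (fun v _ => pow_pos (norm_pos_iff.2 (emb_ne_zero v h)) _)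
          (fun v _ => pow_lt_one₀ (norm_nonneg _) (hx v) v.mult_ne_zero) ⟨v₀, Finset.mem_univ _⟩
    _ = 1 := by simp

theorem finite_norm_emb_le (B : ℝ) :
    {x : 𝓞 K | ∀ v : InfinitePlace K, ‖emb v x‖ ≤ B}.Finite := by
  refine Set.Finite.of_finite_image ((Embeddings.finite_of_norm_le K ℂ B).subset ?_)
    (RingOfIntegers.coe_injective (K := K)).injOn
  rintro _ ⟨x, hx, rfl⟩
  refine ⟨x.isIntegral_coe, fun φ => ?_⟩
  have := hx (InfinitePlace.mk φ)
  rwa [norm_emb, InfinitePlace.apply] at this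

/-- The elements of `SL(2, 𝓞_K)` with entries bounded at all places are finite in number. -/
theorem finite_specialLinearGroup_norm_emb_le (B : ℝ) :
    {γ : Matrix.SpecialLinearGroup (Fin 2) (𝓞 K) |
      ∀ (v : InfinitePlace K) i j, ‖emb v (γ i j)‖ ≤ B}.Finite := by
  have h : {m : Fin 2 → Fin 2 → 𝓞 K | ∀ i j, m i j ∈
      {x : 𝓞 K | ∀ v : InfinitePlace K, ‖emb v x‖ ≤ B}}.Finite := by
    have := Set.Finite.pi' (fun _ : Fin 2 => Set.Finite.pi' fun _ : Fin 2 =>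
      finite_norm_emb_le (K := K) B)
    exact this
  exact Set.Finite.subset (h.preimage (f := fun γ : Matrix.SpecialLinearGroup (Fin 2) (𝓞 K) =>
    (γ : Matrix (Fin 2) (Fin 2) (𝓞 K))) Subtype.val_injective.injOn) fun γ hγ i j v => hγ v i j

theorem diagEmb_apply (γ : Matrix.SpecialLinearGroup (Fin 2) (𝓞 K)) (v : InfinitePlace K)
    (i j : Fin 2) : diagEmb K γ v i j = emb v (γ i j) := rfl

/-- `Γ` meets every compact set in a finite set. -/
theorem finite_Γ_inter_norm_le (B : ℝ) :
    ((Γ K : Set (G K)) ∩ {g | ∀ v i j, ‖g v i j‖ ≤ B}).Finite := by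
  refine ((finite_specialLinearGroup_norm_emb_le (K := K) B).image (diagEmb K)).subset ?_
  rintro _ ⟨⟨γ, rfl⟩, hγ⟩
  exact ⟨γ, hγ, rfl⟩

theorem le_sum_sum_sum {ι : Type*} [Fintype ι] {f : ι → Fin 2 → Fin 2 → ℝ}
    (hf : ∀ v i j, 0 ≤ f v i j) (v : ι) (i j : Fin 2) : f v i j ≤ ∑ v, ∑ i, ∑ j, f v i j :=
  calc f v i j ≤ ∑ j, f v i j :=
        Finset.single_le_sum (f := fun j => f v i j) (fun _ _ => hf _ _ _) (Finset.mem_univ j)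
    _ ≤ ∑ i, ∑ j, f v i j :=
        Finset.single_le_sum (f := fun i => ∑ j, f v i j)
          (fun _ _ => Finset.sum_nonneg fun _ _ => hf _ _ _) (Finset.mem_univ i)
    _ ≤ _ := Finset.single_le_sum (f := fun v => ∑ i, ∑ j, f v i j)
          (fun _ _ => Finset.sum_nonneg fun _ _ => Finset.sum_nonneg fun _ _ => hf _ _ _)
          (Finset.mem_univ v)

instance isClosed_Γ : IsClosed (Γ K : Set (G K)) := by
  rw [← isSeqClosed_iff_isClosed]
  intro u z hu hz
  -- a convergent sequence in `Γ` is bounded, hence takes finitely many values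
  have hb : ∃ B : ℝ, ∀ n v i j, ‖u n v i j‖ ≤ B := by
    have h1 : ∀ v i j, ∃ B : ℝ, ∀ n, ‖u n v i j‖ ≤ B := fun v i j => by
      have := (((continuous_entry (K := K) v i j).tendsto z).comp hz).norm.bddAbove_range
      obtain ⟨B, hB⟩ := this
      exact ⟨B, fun n => hB ⟨n, rfl⟩⟩
    choose B hB using h1
    exact ⟨∑ v, ∑ i, ∑ j, |B v i j|, fun n v i j => ((hB v i j n).trans (le_abs_self _)).trans
      (le_sum_sum_sum (f := fun v i j => |B v i j|) (fun _ _ _ => abs_nonneg _) v i j)⟩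
  obtain ⟨B, hB⟩ := hb
  exact ((finite_Γ_inter_norm_le B).isClosed.mem_of_tendsto hz
    (Eventually.of_forall fun n => ⟨hu n, hB n⟩)).1

instance countable_integers : Countable (𝓞 K) := by
  have : (Set.univ : Set (𝓞 K)) = ⋃ n : ℕ, {x : 𝓞 K | ∀ v : InfinitePlace K, ‖emb v x‖ ≤ n} := by
    refine (Set.eq_univ_of_forall fun x => ?_).symm
    obtain ⟨n, hn⟩ := exists_nat_ge (∑ v : InfinitePlace K, ‖emb v x‖)
    exact Set.mem_iUnion.2 ⟨n, fun v => (Finset.single_le_sum (f := fun v : InfinitePlace K =>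
      ‖emb v x‖) (fun _ _ => norm_nonneg _) (Finset.mem_univ v)).trans hn⟩
  rw [← Set.countable_univ_iff, this]
  exact Set.countable_iUnion fun n => (finite_norm_emb_le _).countable

instance countable_specialLinearGroup_integers :
    Countable (Matrix.SpecialLinearGroup (Fin 2) (𝓞 K)) := by
  have : Countable (Matrix (Fin 2) (Fin 2) (𝓞 K)) :=
    inferInstanceAs (Countable (Fin 2 → Fin 2 → 𝓞 K))
  exact Subtype.val_injective.countable

instance : T2Space (Space K) := inferInstance

instance locallyCompactSpace_Space : LocallyCompactSpace (Space K) :=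
  QuotientGroup.instLocallyCompactSpace _

end

/-! ### Minkowski's theorem for the lattices `g 𝓞_K²` -/

section

variable {K : Type*} [Field K] [NumberField K]

/-- The `v`-component of the vector `g w`, for `g ∈ G` and `w ∈ 𝓞_K²`. -/
noncomputable def vec (g : G K) (w : Fin 2 → 𝓞 K) (v : InfinitePlace K) : Fin 2 → v.Completion :=
  fun i => g v i 0 * emb v (w 0) + g v i 1 * emb v (w 1)

theorem vec_mul (h g : G K) (w : Fin 2 → 𝓞 K) (v : InfinitePlace K) (i : Fin 2) :
    vec (h * g) w v i = h v i 0 * vec g w v 0 + h v i 1 * vec g w v 1 := by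
  have : ∀ j, (h * g) v i j = h v i 0 * g v 0 j + h v i 1 * g v 1 j := fun j => by
    simp [Matrix.mul_apply, Fin.sum_univ_two]
  simp only [vec, this]
  ring

/-- The identification of `∏ K_v` with `ℝ^r₁ × ℂ^r₂`. -/
noncomputable def completionsEquiv (K : Type*) [Field K] :
    (∀ v : InfinitePlace K, v.Completion) ≃+* mixedEmbedding.mixedSpace K :=
  InfiniteAdeleRing.ringEquiv_mixedSpace K

omit [NumberField K] in
theorem completionsEquiv_apply (x : ∀ v : InfinitePlace K, v.Completion) :
    completionsEquiv K x =
      (fun v : {w : InfinitePlace K // w.IsReal} =>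
        InfinitePlace.Completion.extensionEmbeddingOfIsReal v.2 (x v),
       fun v : {w : InfinitePlace K // w.IsComplex} =>
        InfinitePlace.Completion.extensionEmbedding v.1 (x v)) := rfl

omit [NumberField K] in
theorem completionsEquiv_emb (x : 𝓞 K) :
    completionsEquiv K (fun v => emb v x) = mixedEmbedding K x :=
  InfiniteAdeleRing.mixedEmbedding_eq_algebraMap_comp (K := K).symm

omit [NumberField K] in
theorem mem_convexBodyLT_completionsEquiv (f : InfinitePlace K → NNReal)
    (y : ∀ v : InfinitePlace K, v.Completion) :
    completionsEquiv K y ∈ mixedEmbedding.convexBodyLT K f ↔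
      ∀ v, ‖y v‖ < f v := by
  have h1 : ∀ (v : InfinitePlace K) (hv : v.IsReal),
      ‖InfinitePlace.Completion.extensionEmbeddingOfIsReal hv (y v)‖ = ‖y v‖ := fun v hv =>
    (InfinitePlace.Completion.isometry_extensionEmbeddingOfIsReal hv).norm_map_of_map_zero
      (map_zero _) _
  have h2 : ∀ (v : InfinitePlace K),
      ‖InfinitePlace.Completion.extensionEmbedding v (y v)‖ = ‖y v‖ := fun v =>
    (InfinitePlace.Completion.isometry_extensionEmbedding v).norm_map_of_map_zero (map_zero _) _
  rw [completionsEquiv_apply]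
  simp only [Set.mem_prod, Set.mem_pi, Set.mem_univ, forall_true_left, mem_ball_zero_iff,
    Subtype.forall, h1, h2, ← InfinitePlace.not_isReal_iff_isComplex]
  constructor
  · rintro ⟨h, h'⟩ v
    by_cases hv : v.IsReal
    exacts [h v hv, h' v hv]
  · exact fun h => ⟨fun v _ => h v, fun v _ => h v⟩

/-- Minkowski's theorem for the square of a lattice, a linear map of determinant `1` and a product
of two convex bodies. -/
theorem exists_ne_zero_mem_span_pair {S ι : Type*} [NormedAddCommGroup S] [NormedSpace ℝ S]
    [FiniteDimensional ℝ S] [MeasureSpace S] [BorelSpace S]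
    [(volume : Measure S).IsAddHaarMeasure] [Finite ι] (b : Module.Basis ι ℝ S) :
    ∃ M : NNReal, ∀ f : (Fin 2 → S) →ₗ[ℝ] (Fin 2 → S), LinearMap.det f = 1 → ∀ s : Fin 2 → Set S,
      (∀ i, ∀ x ∈ s i, -x ∈ s i) → (∀ i, Convex ℝ (s i)) → M < volume (s 0) * volume (s 1) →
      ∃ x : Fin 2 → S, x ≠ 0 ∧ (∀ i, x i ∈ Submodule.span ℤ (Set.range b)) ∧ ∀ i, f x i ∈ s i := by
  cases nonempty_fintype ι
  have : SecondCountableTopology S :=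
    haveI := FiniteDimensional.proper_real S
    secondCountable_of_proper
  let B := Pi.basis fun _ : Fin 2 => b
  have hF : volume (ZSpan.fundamentalDomain B) * 2 ^ Module.finrank ℝ (Fin 2 → S) ≠ ⊤ :=
    ENNReal.mul_ne_top (ZSpan.fundamentalDomain_isBounded B).measure_lt_top.ne (by finiteness)
  refine ⟨(volume (ZSpan.fundamentalDomain B) * 2 ^ Module.finrank ℝ (Fin 2 → S)).toNNReal,
    fun f hf s hneg hconv hM => ?_⟩
  rw [ENNReal.coe_toNNReal hF] at hM
  have : Countable (Submodule.span ℤ (Set.range B)).toAddSubgroup :=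
    inferInstanceAs (Countable (Submodule.span ℤ (Set.range B)))
  obtain ⟨⟨x, hxL⟩, hx0, hxs⟩ := exists_ne_zero_mem_lattice_of_measure_mul_two_pow_lt_measure
    (μ := volume) (s := f ⁻¹' Set.univ.pi s) (ZSpan.isAddFundamentalDomain' B volume)
    (fun x hx i hi => by
      rw [map_neg]
      exact hneg i _ (hx i hi))
    (Convex.linear_preimage (convex_pi fun i _ => hconv i) f)
    (by
      rw [Measure.addHaar_preimage_linearMap _ (by rw [hf]; exact one_ne_zero), hf, volume_pi_pi,
        Fin.prod_univ_two]
      simpa using hM)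
  refine ⟨x, fun h => hx0 (Subtype.ext h), fun i => ?_, fun i => hxs i (Set.mem_univ i)⟩
  rw [Module.Basis.mem_span_iff_repr_mem]
  intro j
  have := ((B.mem_span_iff_repr_mem ℤ x).1 hxL) ⟨i, j⟩
  rwa [Pi.basis_repr] at this

open scoped Classical in
/-- The box `‖y₀‖ < a`, `‖y₁‖ < b` contains a nonzero vector of every lattice `g 𝓞_K²`, if
`(a b) ^ [K : ℚ]` is larger than a constant that depends on `K` only. -/
theorem exists_vec_lt (K : Type*) [Field K] [NumberField K] :
    ∃ C : ℝ, ∀ (g : G K) (a b : NNReal), C < ((a * b) ^ Module.finrank ℚ K : NNReal) →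
      ∃ w : Fin 2 → 𝓞 K, w ≠ 0 ∧ ∀ v, ‖vec g w v 0‖ < a ∧ ‖vec g w v 1‖ < b := by
  obtain ⟨M, hM⟩ := exists_ne_zero_mem_span_pair (mixedEmbedding.latticeBasis K)
  let c : NNReal := mixedEmbedding.convexBodyLTFactor K
  have hc : c ≠ 0 := mixedEmbedding.convexBodyLTFactor_ne_zero K
  refine ⟨(M / c ^ 2 : NNReal), fun g a b hab => ?_⟩
  have hab' : M < c ^ 2 * (a * b) ^ Module.finrank ℚ K := by
    have := (div_lt_iff₀ (by positivity)).1 (NNReal.coe_lt_coe.1 hab)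
    rwa [mul_comm] at this
  let e := completionsEquiv K
  let m : Matrix (Fin 2) (Fin 2) (mixedEmbedding.mixedSpace K) := fun i j => e fun v => g v i j
  have hm : m.det = 1 := by
    rw [Matrix.det_fin_two]
    change e _ * e _ - e _ * e _ = 1
    rw [← map_mul, ← map_mul, ← map_sub, ← map_one e]
    refine congrArg e (funext fun v => ?_)
    have := (g v).det_coe
    rwa [Matrix.det_fin_two] at this
  let f := (Matrix.toLin' m).restrictScalars ℝ
  have hf : LinearMap.det f = 1 := by
    change LinearMap.det ((Matrix.toLin' m).restrictScalars ℝ) = 1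
    rw [LinearMap.det_restrictScalars, LinearMap.det_toLin', hm, map_one]
  let r : Fin 2 → NNReal := ![a, b]
  obtain ⟨x, hx0, hxL, hxs⟩ := hM f hf (fun i => mixedEmbedding.convexBodyLT K fun _ => r i)
    (fun i x hx => mixedEmbedding.convexBodyLT_neg_mem K _ x hx)
    (fun i => mixedEmbedding.convexBodyLT_convex K _)
    (by
      simp only [mixedEmbedding.convexBodyLT_volume, Finset.prod_pow_eq_pow_sum,
        InfinitePlace.sum_mult_eq]
      have : (M : ENNReal) < (c ^ 2 * (a * b) ^ Module.finrank ℚ K : NNReal) := by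
        exact_mod_cast hab'
      refine this.trans_eq ?_
      simp only [c, r, Matrix.cons_val_zero, Matrix.cons_val_one]
      push_cast
      ring)
  have hint : ∀ i, ∃ w : 𝓞 K, mixedEmbedding K w = x i := fun i => by
    obtain ⟨y, hy⟩ := (mixedEmbedding.mem_span_latticeBasis K).1 (hxL i)
    exact ⟨y, hy⟩
  choose w hw using hint
  have hfx : ∀ i, f x i = e fun v => vec g w v i := fun i => by
    change Matrix.mulVec m x i = _
    rw [Matrix.mulVec, dotProduct, Fin.sum_univ_two, ← hw, ← hw,
      ← completionsEquiv_emb, ← completionsEquiv_emb]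
    change e _ * e _ + e _ * e _ = _
    rw [← map_mul, ← map_mul, ← map_add]
    rfl
  have hlt : ∀ i v, ‖vec g w v i‖ < r i := fun i => by
    have := hxs i
    rw [hfx] at this
    exact (mem_convexBodyLT_completionsEquiv _ _).1 this
  refine ⟨w, ?_, fun v => ⟨hlt 0 v, hlt 1 v⟩⟩
  rintro rfl
  refine hx0 (funext fun i => ?_)
  rw [← hw]
  simp

end

/-! ### Mahler's criterion -/

section

variable {K : Type*} [Field K] [NumberField K]

/-- The determinant of the matrix with columns `w` and `w'`. -/
def cross {R : Type*} [CommRing R] (w w' : Fin 2 → R) : R := w 0 * w' 1 - w 1 * w' 0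

theorem det_coe_two {R : Type*} [CommRing R] (g : Matrix.SpecialLinearGroup (Fin 2) R) :
    g 0 0 * g 1 1 - g 0 1 * g 1 0 = 1 := by
  rw [← Matrix.det_fin_two]
  exact g.det_coe

theorem cross_vec (g : G K) (w w' : Fin 2 → 𝓞 K) (v : InfinitePlace K) :
    cross (vec g w v) (vec g w' v) = emb v (cross w w') := by
  have h := det_coe_two (g v)
  simp only [cross, vec, map_sub, map_mul]
  linear_combination (emb v (w 0) * emb v (w' 1) - emb v (w 1) * emb v (w' 0)) * h

theorem vec_ne_zero (g : G K) {w : Fin 2 → 𝓞 K} (hw : w ≠ 0) (v : InfinitePlace K) :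
    vec g w v ≠ 0 := by
  intro h
  refine hw (funext fun i => ?_)
  have h0 : vec g w v 0 = 0 := congrFun h 0
  have h1 : vec g w v 1 = 0 := congrFun h 1
  have hd := det_coe_two (g v)
  apply emb_injective v
  simp only [vec] at h0 h1
  fin_cases i
  · simp only [Pi.zero_apply, map_zero]
    change emb v (w 0) = 0
    linear_combination g v 1 1 * h0 - g v 0 1 * h1 - emb v (w 0) * hd
  · simp only [Pi.zero_apply, map_zero]
    change emb v (w 1) = 0
    linear_combination g v 0 0 * h1 - g v 1 0 * h0 - emb v (w 1) * hd

/-- Every vector of `F²` is carried to the first coordinate axis by a matrix in `SL(2, F)` whose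
entries have norm at most `1`. -/
theorem exists_frame {F : Type*} [NormedField F] (p q : F) :
    ∃ k : Matrix.SpecialLinearGroup (Fin 2) F,
      (∀ i j, ‖k i j‖ ≤ 1) ∧ k 1 0 * p + k 1 1 * q = 0 := by
  rcases le_total ‖q‖ ‖p‖ with h | h
  · refine ⟨⟨!![1, 0; -(q / p), 1], by simp [Matrix.det_fin_two]⟩, fun i j => ?_, ?_⟩
    · have : ‖q‖ / ‖p‖ ≤ 1 := div_le_one_of_le₀ h (norm_nonneg _)
      fin_cases i <;> fin_cases j <;> simp [this]
    · by_cases hp : p = 0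
      · have : q = 0 := by simpa [hp] using h
        simp [hp, this]
      · change -(q / p) * p + 1 * q = 0
        field_simp
        ring
  · refine ⟨⟨!![0, 1; -1, p / q], by simp [Matrix.det_fin_two]⟩, fun i j => ?_, ?_⟩
    · have : ‖p‖ / ‖q‖ ≤ 1 := div_le_one_of_le₀ h (norm_nonneg _)
      fin_cases i <;> fin_cases j <;> simp [this]
    · by_cases hq : q = 0
      · have : p = 0 := by simpa [hq] using h
        simp [hq, this]
      · change -1 * p + p / q * q = 0
        field_simp
        ring

/-- If `g 𝓞_K²` has no vector shorter than `ε`, then every line of `K²` is avoided by some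
`w ∈ 𝓞_K²` with `g w` bounded in terms of `ε`. -/
theorem exists_cross_ne_zero_norm_vec_le {ε : ℝ} (hε : 0 < ε) :
    ∃ R : ℝ, ∀ g : G K, (∀ w : Fin 2 → 𝓞 K, w ≠ 0 → ∃ v i, ε ≤ ‖vec g w v i‖) →
      ∀ w₀ : Fin 2 → 𝓞 K, w₀ ≠ 0 →
        ∃ w : Fin 2 → 𝓞 K, cross w₀ w ≠ 0 ∧ ∀ v i, ‖vec g w v i‖ ≤ R := by
  obtain ⟨C, hC⟩ := exists_vec_lt K
  let a : NNReal := ⟨ε, hε.le⟩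
  have ha : a ≠ 0 := fun h => hε.ne' (congrArg NNReal.toReal h)
  let c : NNReal := ⟨|C| + 1, by positivity⟩
  refine ⟨a + (c / a : NNReal), fun g hg w₀ hw₀ => ?_⟩
  choose k hk hk0 using fun v => exists_frame (vec g w₀ v 0) (vec g w₀ v 1)
  obtain ⟨w, hw, hwk⟩ := hC (k * g) a (c / a) (by
    rw [mul_div_cancel₀ _ ha]
    push_cast
    calc C < |C| + 1 := (le_abs_self C).trans_lt (lt_add_one _)
      _ ≤ (|C| + 1) ^ Module.finrank ℚ K :=
        le_self_pow₀ (by linarith [abs_nonneg C]) Module.finrank_pos.ne')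
  have e0 : ∀ v, vec g w v 0 = k v 1 1 * vec (k * g) w v 0 - k v 0 1 * vec (k * g) w v 1 :=
    fun v => by
      rw [vec_mul, vec_mul]
      linear_combination - vec g w v 0 * det_coe_two (k v)
  have e1 : ∀ v, vec g w v 1 = k v 0 0 * vec (k * g) w v 1 - k v 1 0 * vec (k * g) w v 0 :=
    fun v => by
      rw [vec_mul, vec_mul]
      linear_combination - vec g w v 1 * det_coe_two (k v)
  have hmul : ∀ {v : InfinitePlace K} (i j : Fin 2) (x : v.Completion), ‖k v i j * x‖ ≤ ‖x‖ :=
    fun {v} i j x => by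
      rw [norm_mul]
      exact mul_le_of_le_one_left (norm_nonneg _) (hk v i j)
  refine ⟨w, fun h0 => ?_, fun v i => ?_⟩
  · -- on the line `K w₀` the second coordinate of `k g w` vanishes, so that `g w` is too short
    have hz : ∀ v, vec (k * g) w v 1 = 0 := fun v => by
      have hc := cross_vec (k * g) w₀ w v
      have h1 : vec (k * g) w₀ v 1 = 0 := by rw [vec_mul]; exact hk0 v
      have hne : vec (k * g) w₀ v 0 ≠ 0 := fun h =>
        vec_ne_zero (k * g) hw₀ v (funext fun i => by fin_cases i <;> [exact h; exact h1])
      rw [h0, map_zero, cross, h1, zero_mul, sub_zero] at hc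
      exact (mul_eq_zero.1 hc).resolve_left hne
    obtain ⟨v, i, hvi⟩ := hg w hw
    refine absurd hvi (not_le.2 ?_)
    have : ‖vec (k * g) w v 0‖ < ε := (hwk v).1
    refine lt_of_le_of_lt ?_ this
    fin_cases i
    · change ‖vec g w v 0‖ ≤ _
      rw [e0, hz, mul_zero, sub_zero]
      exact hmul _ _ _
    · change ‖vec g w v 1‖ ≤ _
      rw [e1, hz, mul_zero, zero_sub, norm_neg]
      exact hmul _ _ _
  · fin_cases i
    · change ‖vec g w v 0‖ ≤ _
      rw [e0]
      exact (norm_sub_le _ _).trans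
        (add_le_add ((hmul _ _ _).trans (hwk v).1.le) ((hmul _ _ _).trans (hwk v).2.le))
    · change ‖vec g w v 1‖ ≤ _
      rw [e1, add_comm]
      exact (norm_sub_le _ _).trans
        (add_le_add ((hmul _ _ _).trans (hwk v).2.le) ((hmul _ _ _).trans (hwk v).1.le))

/-- The integral matrices of a given nonzero determinant form finitely many classes modulo
`SL(2, 𝓞_K)`: matrices that agree modulo the determinant are in the same class. -/
theorem exists_finite_representatives {δ : 𝓞 K} (hδ : δ ≠ 0) :
    ∃ T : Set (Matrix (Fin 2) (Fin 2) (𝓞 K)), T.Finite ∧ (∀ W ∈ T, W.det = δ) ∧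
      ∀ W : Matrix (Fin 2) (Fin 2) (𝓞 K), W.det = δ →
        ∃ γ : Matrix.SpecialLinearGroup (Fin 2) (𝓞 K), ∃ W' ∈ T,
          (γ : Matrix (Fin 2) (Fin 2) (𝓞 K)) * W' = W := by
  have : Finite (𝓞 K ⧸ Ideal.span {δ}) :=
    Ideal.finiteQuotientOfFreeOfNeBot _ (by simpa using hδ)
  have : Finite (Matrix (Fin 2) (Fin 2) (𝓞 K ⧸ Ideal.span {δ})) :=
    inferInstanceAs (Finite (Fin 2 → Fin 2 → _))
  let f : Matrix (Fin 2) (Fin 2) (𝓞 K) → Matrix (Fin 2) (Fin 2) (𝓞 K ⧸ Ideal.span {δ}) :=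
    fun W => W.map (Ideal.Quotient.mk _)
  obtain ⟨T, hTs, hT⟩ := Set.exists_subset_bijOn {W : Matrix (Fin 2) (Fin 2) (𝓞 K) | W.det = δ} f
  refine ⟨T, Set.Finite.of_finite_image (Set.toFinite _) hT.injOn, fun W hW => hTs hW,
    fun W hW => ?_⟩
  obtain ⟨W', hW', hWW'⟩ := hT.surjOn ⟨W, hW, rfl⟩
  have hdet : W'.det = δ := hTs hW'
  have hdvd : ∀ i j, δ ∣ (W * W'.adjugate) i j := fun i j => by
    rw [← Ideal.mem_span_singleton, ← Ideal.Quotient.eq_zero_iff_mem]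
    have h1 : f (W * W'.adjugate) = f (W' * W'.adjugate) := by
      simp only [f, Matrix.map_mul]
      congr 1
      exact hWW'.symm
    have h2 := congrFun (congrFun h1 i) j
    simp only [f, Matrix.map_apply, Matrix.mul_adjugate, hdet, Matrix.smul_apply, smul_eq_mul,
      map_mul] at h2
    rw [h2, Ideal.Quotient.eq_zero_iff_mem.2 (Ideal.mem_span_singleton_self δ), zero_mul]
  choose q hq using hdvd
  have hq' : W * W'.adjugate = δ • Matrix.of q := by
    ext i j
    rw [hq, Matrix.smul_apply, Matrix.of_apply, smul_eq_mul]
  have hqdet : (Matrix.of q).det = 1 := by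
    have := congrArg Matrix.det hq'
    rw [Matrix.det_mul, Matrix.det_adjugate, hW, hdet, Matrix.det_smul, Fintype.card_fin] at this
    have h2 : δ ^ 2 ≠ 0 := pow_ne_zero _ hδ
    refine mul_left_cancel₀ h2 ?_
    linear_combination - this
  refine ⟨⟨Matrix.of q, hqdet⟩, W', hW', ?_⟩
  have h3 : δ • (Matrix.of q * W') = δ • W := by
    rw [← Matrix.smul_mul, ← hq', Matrix.mul_assoc, Matrix.adjugate_mul, hdet, Matrix.mul_smul,
      Matrix.mul_one]
  exact smul_right_injective _ hδ h3

/-- If `g 𝓞_K²` has no vector shorter than `ε`, then `g Γ` has an element with entries bounded in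
terms of `ε`. -/
theorem exists_norm_mul_diagEmb_le {ε : ℝ} (hε : 0 < ε) :
    ∃ R : ℝ, ∀ g : G K, (∀ w : Fin 2 → 𝓞 K, w ≠ 0 → ∃ v i, ε ≤ ‖vec g w v i‖) →
      ∃ γ : Matrix.SpecialLinearGroup (Fin 2) (𝓞 K), ∀ v i j,
        ‖(g * diagEmb K γ) v i j‖ ≤ R := by
  obtain ⟨R, hR⟩ := exists_cross_ne_zero_norm_vec_le (K := K) hε
  have hrep : ∀ δ : 𝓞 K, ∃ T : Set (Matrix (Fin 2) (Fin 2) (𝓞 K)), T.Finite ∧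
      (∀ W ∈ T, δ ≠ 0 → W.det = δ) ∧
      ∀ W : Matrix (Fin 2) (Fin 2) (𝓞 K), δ ≠ 0 → W.det = δ →
        ∃ γ : Matrix.SpecialLinearGroup (Fin 2) (𝓞 K), ∃ W' ∈ T,
          (γ : Matrix (Fin 2) (Fin 2) (𝓞 K)) * W' = W := fun δ => by
    by_cases hδ : δ = 0
    · exact ⟨∅, Set.finite_empty, by simp, fun _ h => absurd hδ h⟩
    · obtain ⟨T, h1, h2, h3⟩ := exists_finite_representatives hδ
      exact ⟨T, h1, fun W hW _ => h2 W hW, fun W _ hW => h3 W hW⟩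
  choose T hTfin hTdet hT using hrep
  have hfin : (⋃ δ ∈ {x : 𝓞 K | ∀ v : InfinitePlace K, ‖emb v x‖ ≤ R * R + R * R}, T δ).Finite :=
    (finite_norm_emb_le _).biUnion fun δ _ => hTfin δ
  let β : Matrix (Fin 2) (Fin 2) (𝓞 K) → ℝ := fun W =>
    ∑ v : InfinitePlace K, ∑ i, ∑ j, ‖emb v (W.adjugate i j)‖ / ‖emb v W.det‖
  obtain ⟨B, hB⟩ := (hfin.image β).bddAbove
  refine ⟨R * B + R * B, fun g hg => ?_⟩
  have he : (fun _ => 1 : Fin 2 → 𝓞 K) ≠ 0 := fun h => one_ne_zero (congrFun h 0)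
  obtain ⟨w₁, h01, hw₁⟩ := hR g hg _ he
  have hw₁0 : w₁ ≠ 0 := by
    rintro rfl
    simp [cross] at h01
  obtain ⟨w₂, h12, hw₂⟩ := hR g hg _ hw₁0
  have hR0 : 0 ≤ R := by
    obtain ⟨v⟩ := (inferInstance : Nonempty (InfinitePlace K))
    exact (norm_nonneg _).trans (hw₁ v 0)
  let W : Matrix (Fin 2) (Fin 2) (𝓞 K) := !![w₁ 0, w₂ 0; w₁ 1, w₂ 1]
  have hWdet : W.det = cross w₁ w₂ := by
    simp only [W, Matrix.det_fin_two_of, cross]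
    ring
  have hδ : ∀ v : InfinitePlace K, ‖emb v W.det‖ ≤ R * R + R * R := fun v => by
    rw [hWdet, ← cross_vec g]
    refine (norm_sub_le _ _).trans (add_le_add ?_ ?_) <;>
    · rw [norm_mul]
      exact mul_le_mul (hw₁ v _) (hw₂ v _) (norm_nonneg _) hR0
  have hWne : W.det ≠ 0 := hWdet ▸ h12
  obtain ⟨γ, W', hW', hγ⟩ := hT W.det W hWne rfl
  have hW'det := hTdet W.det W' hW' hWne
  have hβ : β W' ≤ B := hB ⟨W', Set.mem_biUnion (show W.det ∈ {x : 𝓞 K | _} from hδ) hW', rfl⟩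
  have hadj : ∀ (v : InfinitePlace K) i j,
      ‖emb v (W'.adjugate i j)‖ / ‖emb v W.det‖ ≤ B := fun v i j => by
    rw [← hW'det]
    exact (le_sum_sum_sum (f := fun (v : InfinitePlace K) i j =>
      ‖emb v (W'.adjugate i j)‖ / ‖emb v W'.det‖) (fun _ _ _ => by positivity) v i j).trans hβ
  refine ⟨γ, fun v i j => ?_⟩
  -- `γ δ = W adj(W')`, so that `(g γ) δ = (g W) adj(W')`, where `δ = det W`
  have hγδ : ∀ i j, γ i j * W.det = W i 0 * W'.adjugate 0 j + W i 1 * W'.adjugate 1 j :=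
    fun i j => by
      have h : (γ : Matrix (Fin 2) (Fin 2) (𝓞 K)) * (W' * W'.adjugate) = W * W'.adjugate := by
        rw [← Matrix.mul_assoc, hγ]
      rw [Matrix.mul_adjugate, hW'det, Matrix.mul_smul, Matrix.mul_one] at h
      have := congrFun (congrFun h i) j
      rw [Matrix.smul_apply, Matrix.mul_apply, Fin.sum_univ_two, smul_eq_mul] at this
      rw [mul_comm, this]
  have hne := emb_ne_zero v hWne
  have key : (g * diagEmb K γ) v i j = vec g w₁ v i * (emb v (W'.adjugate 0 j) / emb v W.det) +
      vec g w₂ v i * (emb v (W'.adjugate 1 j) / emb v W.det) := by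
    have h0 := congrArg (emb v) (hγδ 0 j)
    have h1 := congrArg (emb v) (hγδ 1 j)
    simp only [map_mul, map_add] at h0 h1
    have hexp : (g * diagEmb K γ) v i j = g v i 0 * emb v (γ 0 j) + g v i 1 * emb v (γ 1 j) := by
      simp only [Pi.mul_apply, Matrix.SpecialLinearGroup.coe_mul, Matrix.mul_apply,
        Fin.sum_univ_two, diagEmb_apply]
    rw [hexp]
    have hW : W 0 0 = w₁ 0 ∧ W 0 1 = w₂ 0 ∧ W 1 0 = w₁ 1 ∧ W 1 1 = w₂ 1 :=
      ⟨rfl, rfl, rfl, rfl⟩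
    rw [hW.1, hW.2.1] at h0
    rw [hW.2.2.1, hW.2.2.2] at h1
    simp only [vec]
    field_simp
    linear_combination g v i 0 * h0 + g v i 1 * h1
  rw [key]
  refine (norm_add_le _ _).trans ?_
  rw [norm_mul, norm_mul, norm_div, norm_div]
  exact add_le_add (mul_le_mul (hw₁ v i) (hadj v 0 j) (by positivity) hR0)
    (mul_le_mul (hw₂ v i) (hadj v 1 j) (by positivity) hR0)

/-- Mahler's criterion: outside a compact subset of `G/Γ` that depends on `ε` only, the lattice
`g 𝓞_K²` has a nonzero vector shorter than `ε`. -/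
theorem exists_isCompact_forall_notMem {ε : ℝ} (hε : 0 < ε) :
    ∃ C : Set (Space K), IsCompact C ∧ ∀ g : G K, π g ∉ C →
      ∃ w : Fin 2 → 𝓞 K, w ≠ 0 ∧ ∀ v i, ‖vec g w v i‖ < ε := by
  obtain ⟨R, hR⟩ := exists_norm_mul_diagEmb_le (K := K) hε
  refine ⟨π '' {g : G K | ∀ v i j, ‖g v i j‖ ≤ R},
    (isCompact_norm_le R).image QuotientGroup.continuous_mk, fun g hg => ?_⟩
  by_contra! h
  obtain ⟨γ, hγ⟩ := hR g h
  exact hg ⟨g * diagEmb K γ, hγ, QuotientGroup.mk_mul_of_mem g ⟨γ, rfl⟩⟩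

end

/-! ### The exponential parametrization of the diagonal subgroups -/

section

variable {K : Type*} [Field K]

/-- The projection of `ℂ` onto `ℝ` at a real place, the identity at a complex one. -/
noncomputable def placeProj (v : InfinitePlace K) (s : ℂ) : ℂ :=
  open scoped Classical in if v.IsReal then (s.re : ℂ) else s

theorem placeProj_of_isReal {v : InfinitePlace K} (hv : v.IsReal) (s : ℂ) :
    placeProj v s = (s.re : ℂ) := if_pos hv

theorem placeProj_of_not_isReal {v : InfinitePlace K} (hv : ¬ v.IsReal) (s : ℂ) :
    placeProj v s = s := if_neg hv

theorem placeProj_add (v : InfinitePlace K) (s t : ℂ) :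
    placeProj v (s + t) = placeProj v s + placeProj v t := by
  by_cases hv : v.IsReal
  · simp [placeProj_of_isReal hv]
  · simp [placeProj_of_not_isReal hv]

theorem placeProj_ofReal (v : InfinitePlace K) (s : ℝ) : placeProj v (s : ℂ) = s := by
  by_cases hv : v.IsReal
  · simp [placeProj_of_isReal hv]
  · simp [placeProj_of_not_isReal hv]

theorem continuous_placeProj (v : InfinitePlace K) : Continuous (placeProj v) := by
  by_cases hv : v.IsReal
  · simpa only [placeProj_of_isReal hv, funext_iff] using
      (Complex.continuous_ofReal.comp Complex.continuous_re).congr fun s =>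
        (placeProj_of_isReal hv s).symm
  · exact continuous_id.congr fun s => (placeProj_of_not_isReal hv s).symm

theorem norm_extensionEmbedding (v : InfinitePlace K) (x : v.Completion) :
    ‖InfinitePlace.Completion.extensionEmbedding v x‖ = ‖x‖ :=
  (InfinitePlace.Completion.isometry_extensionEmbedding v).norm_map_of_map_zero (map_zero _) _

theorem exists_extensionEmbedding_eq_exp (v : InfinitePlace K) (s : ℂ) :
    ∃ x : v.Completionˣ, InfinitePlace.Completion.extensionEmbedding v (x : v.Completion) =
      Complex.exp (placeProj v s) := by
  obtain ⟨x, hx⟩ : ∃ x : v.Completion, InfinitePlace.Completion.extensionEmbedding v x =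
      Complex.exp (placeProj v s) := by
    by_cases hv : v.IsReal
    · obtain ⟨x, hx⟩ := InfinitePlace.Completion.surjective_extensionEmbeddingOfIsReal hv
        (Real.exp s.re)
      refine ⟨x, ?_⟩
      rw [← InfinitePlace.Completion.extensionEmbeddingOfIsReal_apply hv, hx,
        placeProj_of_isReal hv, Complex.ofReal_exp]
    · exact InfinitePlace.Completion.surjective_extensionEmbedding_of_isComplex
        (InfinitePlace.not_isReal_iff_isComplex.1 hv) _
  refine ⟨Units.mk0 x ?_, hx⟩
  rintro rfl
  exact Complex.exp_ne_zero _ (hx.symm.trans (map_zero _))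

/-- The exponential map `ℂ → K_vˣ`; at a real place it only depends on the real part of its
argument, so that it is surjective onto the identity component. -/
noncomputable def expUnit (v : InfinitePlace K) (s : ℂ) : v.Completionˣ :=
  (exists_extensionEmbedding_eq_exp v s).choose

theorem extensionEmbedding_expUnit (v : InfinitePlace K) (s : ℂ) :
    InfinitePlace.Completion.extensionEmbedding v (expUnit v s : v.Completion) =
      Complex.exp (placeProj v s) :=
  (exists_extensionEmbedding_eq_exp v s).choose_spec

theorem units_ext_extensionEmbedding {v : InfinitePlace K} {x y : v.Completionˣ}
    (h : InfinitePlace.Completion.extensionEmbedding v (x : v.Completion) =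
      InfinitePlace.Completion.extensionEmbedding v (y : v.Completion)) : x = y :=
  Units.ext ((InfinitePlace.Completion.extensionEmbedding v).injective h)

theorem expUnit_add (v : InfinitePlace K) (s t : ℂ) :
    expUnit v (s + t) = expUnit v s * expUnit v t := by
  apply units_ext_extensionEmbedding
  rw [Units.val_mul, map_mul]
  simp only [extensionEmbedding_expUnit, placeProj_add, Complex.exp_add]

theorem expUnit_zero (v : InfinitePlace K) : expUnit v 0 = 1 := by
  have := expUnit_add v 0 0
  rw [add_zero] at this
  exact left_eq_mul.1 this

theorem expUnit_neg (v : InfinitePlace K) (s : ℂ) : expUnit v (-s) = (expUnit v s)⁻¹ := by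
  rw [eq_inv_iff_mul_eq_one, ← expUnit_add, neg_add_cancel, expUnit_zero]

theorem norm_expUnit_ofReal (v : InfinitePlace K) (s : ℝ) :
    ‖(expUnit v (s : ℂ) : v.Completion)‖ = Real.exp s := by
  rw [← norm_extensionEmbedding, extensionEmbedding_expUnit, placeProj_ofReal, Complex.norm_exp,
    Complex.ofReal_re]

theorem continuous_expUnit (v : InfinitePlace K) :
    Continuous fun s => (expUnit v s : v.Completion) := by
  rw [(InfinitePlace.Completion.isometry_extensionEmbedding v).isEmbedding.continuous_iff]
  exact (Complex.continuous_exp.comp (continuous_placeProj v)).congr fun s =>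
    (extensionEmbedding_expUnit v s).symm

theorem expUnit_mem_unitsComponent (v : InfinitePlace K) (s : ℂ) :
    expUnit v s ∈ unitsComponent v := by
  intro hv
  have := extensionEmbedding_expUnit v s
  rw [← InfinitePlace.Completion.extensionEmbeddingOfIsReal_apply hv, placeProj_of_isReal hv,
    ← Complex.ofReal_exp, Complex.ofReal_inj] at this
  rw [this]
  exact Real.exp_pos _

theorem expUnit_log {v : InfinitePlace K} {x : v.Completionˣ} (hx : x ∈ unitsComponent v) :
    expUnit v (Complex.log (InfinitePlace.Completion.extensionEmbedding v (x : v.Completion))) =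
      x := by
  apply units_ext_extensionEmbedding
  rw [extensionEmbedding_expUnit]
  by_cases hv : v.IsReal
  · have h0 := hx hv
    rw [← InfinitePlace.Completion.extensionEmbeddingOfIsReal_apply hv,
      ← Complex.ofReal_log h0.le, placeProj_ofReal, ← Complex.ofReal_exp, Real.exp_log h0]
  · rw [placeProj_of_not_isReal hv, Complex.exp_log]
    simp

theorem posRealUnits_le (v : InfinitePlace K) : posRealUnits v ≤ unitsComponent v := by
  rintro x ⟨a, ha, hxa⟩ hv
  rw [← InfinitePlace.Completion.extensionEmbeddingOfIsReal_apply hv, Complex.ofReal_inj] at hxa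
  rwa [hxa]

theorem mem_posRealUnits_iff {v : InfinitePlace K} {x : v.Completionˣ} :
    x ∈ posRealUnits v ↔ ∃ s : ℝ, expUnit v s = x := by
  constructor
  · rintro ⟨a, ha, hxa⟩
    refine ⟨Real.log a, units_ext_extensionEmbedding ?_⟩
    rw [extensionEmbedding_expUnit, placeProj_ofReal, hxa, ← Complex.ofReal_exp, Real.exp_log ha]
  · rintro ⟨s, rfl⟩
    refine ⟨Real.exp s, Real.exp_pos s, ?_⟩
    rw [extensionEmbedding_expUnit, placeProj_ofReal, Complex.ofReal_exp]

theorem d_apply (v : InfinitePlace K) (x : v.Completionˣ) :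
    d v x 0 0 = (x : v.Completion) ∧ d v x 0 1 = 0 ∧ d v x 1 0 = 0 ∧
      d v x 1 1 = ((x⁻¹ : v.Completionˣ) : v.Completion) :=
  ⟨rfl, rfl, rfl, rfl⟩

theorem continuous_d_expUnit (v : InfinitePlace K) : Continuous fun s => d v (expUnit v s) := by
  refine Continuous.subtype_mk (continuous_matrix fun i j => ?_) _
  fin_cases i <;> fin_cases j
  · exact continuous_expUnit v
  · exact continuous_const
  · exact continuous_const
  · refine ((continuous_expUnit v).comp continuous_neg).congr fun s => ?_
    exact congrArg Units.val (expUnit_neg v s)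

variable [NumberField K]

/-- The exponential map from `∏ᵥ ℂ` onto the group `D` of all places. -/
noncomputable def diagExp (s : InfinitePlace K → ℂ) : G K := fun v => d v (expUnit v (s v))

theorem diagExp_add (s t : InfinitePlace K → ℂ) : diagExp (s + t) = diagExp s * diagExp t :=
  funext fun v => by
    change d v (expUnit v (s v + t v)) = d v (expUnit v (s v)) * d v (expUnit v (t v))
    rw [expUnit_add, map_mul]

theorem diagExp_apply_eq_one {s : InfinitePlace K → ℂ} {v : InfinitePlace K} (hv : s v = 0) :
    diagExp s v = 1 := by
  rw [diagExp, hv, expUnit_zero, map_one]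

theorem diagExp_zero : diagExp (0 : InfinitePlace K → ℂ) = 1 :=
  funext fun _ => diagExp_apply_eq_one rfl

theorem diagExp_neg (s : InfinitePlace K → ℂ) : diagExp (-s) = (diagExp s)⁻¹ := by
  rw [eq_inv_iff_mul_eq_one, ← diagExp_add, neg_add_cancel, diagExp_zero]

theorem continuous_diagExp : Continuous (diagExp (K := K)) :=
  continuous_pi fun v => (continuous_d_expUnit v).comp (continuous_apply v)

/-- The vectors supported on `I`: the Lie algebra of `D_I`. -/
def lieD (I : Finset (InfinitePlace K)) : Submodule ℝ (InfinitePlace K → ℂ) where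
  carrier := {s | ∀ v ∉ I, s v = 0}
  add_mem' ha hb v hv := by simp [ha v hv, hb v hv]
  zero_mem' _ _ := rfl
  smul_mem' c s hs v hv := by simp [hs v hv]

/-- The real vectors supported on `I`: the Lie algebra of `D_{I,ℝ}`. -/
def lieDR (I : Finset (InfinitePlace K)) : Submodule ℝ (InfinitePlace K → ℂ) where
  carrier := {s | (∀ v ∉ I, s v = 0) ∧ ∀ v, (s v).im = 0}
  add_mem' ha hb := ⟨fun v hv => by simp [ha.1 v hv, hb.1 v hv],
    fun v => by simp [ha.2 v, hb.2 v]⟩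
  zero_mem' := ⟨fun _ _ => rfl, fun _ => rfl⟩
  smul_mem' c s hs := ⟨fun v hv => by simp [hs.1 v hv], fun v => by simp [hs.2 v]⟩

theorem coe_D (I : Finset (InfinitePlace K)) : (D I : Set (G K)) = diagExp '' lieD I := by
  ext h
  constructor
  · intro hh
    choose x hx using fun v : InfinitePlace K => fun hv : v ∈ I => (hh v).1 hv
    classical
    refine ⟨fun v => if hv : v ∈ I then
      Complex.log (InfinitePlace.Completion.extensionEmbedding v (x v hv : v.Completion)) else 0,
      fun v hv => dif_neg hv, funext fun v => ?_⟩
    by_cases hv : v ∈ I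
    · simp only [diagExp, dif_pos hv]
      rw [expUnit_log (hx v hv).1, (hx v hv).2]
    · rw [(hh v).2 hv, diagExp_apply_eq_one]
      exact dif_neg hv
  · rintro ⟨s, hs, rfl⟩ v
    exact ⟨fun _ => ⟨_, expUnit_mem_unitsComponent v _, rfl⟩,
      fun hv => diagExp_apply_eq_one (hs v hv)⟩

theorem coe_DR (I : Finset (InfinitePlace K)) : (DR I : Set (G K)) = diagExp '' lieDR I := by
  ext h
  constructor
  · intro hh
    choose x hx using fun v : InfinitePlace K => fun hv : v ∈ I => (hh v).1 hv
    choose s hs using fun v hv => mem_posRealUnits_iff.1 (hx v hv).1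
    classical
    refine ⟨fun v => if hv : v ∈ I then s v hv else 0,
      ⟨fun v hv => dif_neg hv, fun v => ?_⟩, funext fun v => ?_⟩
    · by_cases hv : v ∈ I <;> simp [hv]
    · by_cases hv : v ∈ I
      · simp only [diagExp, dif_pos hv]
        rw [hs, (hx v hv).2]
      · rw [(hh v).2 hv, diagExp_apply_eq_one]
        exact dif_neg hv
  · rintro ⟨s, hs, rfl⟩ v
    refine ⟨fun _ => ⟨_, mem_posRealUnits_iff.2 ⟨(s v).re, ?_⟩, rfl⟩,
      fun hv => diagExp_apply_eq_one (hs.1 v hv)⟩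
    congr 1
    exact Complex.ext rfl (hs.2 v).symm

theorem DR_le_D (I : Finset (InfinitePlace K)) : DR I ≤ D I := fun _ hg v =>
  ⟨fun hv => Subgroup.map_mono (posRealUnits_le v) ((hg v).1 hv), (hg v).2⟩

theorem mem_D_univ_iff {h : G K} : h ∈ D Finset.univ ↔ ∃ s, diagExp s = h := by
  rw [← SetLike.mem_coe, coe_D]
  exact ⟨fun ⟨s, _, hs⟩ => ⟨s, hs⟩,
    fun ⟨s, hs⟩ => ⟨s, fun v hv => absurd (Finset.mem_univ v) hv, hs⟩⟩

/-- A continuous local inverse of `diagExp` at the identity. -/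
noncomputable def diagLog (h : G K) : InfinitePlace K → ℂ :=
  fun v => Complex.log (InfinitePlace.Completion.extensionEmbedding v (h v 0 0))

theorem diagExp_diagLog {h : G K} (hh : h ∈ D Finset.univ) : diagExp (diagLog h) = h := by
  funext v
  obtain ⟨x, hx, hxv⟩ := (hh v).1 (Finset.mem_univ v)
  rw [diagExp, diagLog, ← hxv, (d_apply v x).1, expUnit_log hx]

theorem tendsto_diagLog : Tendsto (diagLog (K := K)) (𝓝 1) (𝓝 0) := by
  have h1 : diagLog (1 : G K) = 0 := funext fun v => by simp [diagLog]
  rw [← h1]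
  refine tendsto_pi_nhds.2 fun v => ?_
  have hc : Continuous fun h : G K =>
      InfinitePlace.Completion.extensionEmbedding v (h v 0 0) :=
    (InfinitePlace.Completion.isometry_extensionEmbedding v).continuous.comp
      (continuous_entry v 0 0)
  exact ContinuousAt.clog hc.continuousAt (by simp)

end

/-! ### Divergent orbits and rational rows -/

section

variable {K : Type*} [Field K] [NumberField K]

theorem cross_eq_zero_trans {R : Type*} [CommRing R] [IsDomain R] {a b c : Fin 2 → R}
    (hb : b ≠ 0) (hab : cross a b = 0) (hbc : cross b c = 0) : cross a c = 0 := by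
  obtain ⟨i, hi⟩ := Function.ne_iff.1 hb
  refine (mul_eq_zero.1 ?_).resolve_left hi
  simp only [cross] at *
  fin_cases i
  · change b 0 * _ = 0
    linear_combination a 0 * hbc + c 0 * hab
  · change b 1 * _ = 0
    linear_combination a 1 * hbc + c 1 * hab

theorem cross_comm_eq_zero {R : Type*} [CommRing R] {a b : Fin 2 → R} (h : cross a b = 0) :
    cross b a = 0 := by
  simp only [cross] at *
  linear_combination -h

/-- The weight of the `j`-th coordinate at the place `u` under the one-parameter group of `D_v`
that expands the `i`-th coordinate at `v`. -/
noncomputable def weight (v : InfinitePlace K) (i : Fin 2) (u : InfinitePlace K) (j : Fin 2) : ℝ :=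
  open scoped Classical in if u = v then (if j = i then 1 else -1) else 0

omit [NumberField K] in
theorem weight_self (v : InfinitePlace K) (i : Fin 2) : weight v i v i = 1 := by simp [weight]

omit [NumberField K] in
theorem weight_of_ne {v u : InfinitePlace K} (h : u ≠ v) (i j : Fin 2) : weight v i u j = 0 := by
  simp [weight, h]

omit [NumberField K] in
theorem weight_add (v : InfinitePlace K) (i : Fin 2) (u : InfinitePlace K) :
    weight v i u 0 + weight v i u 1 = 0 := by
  by_cases h : u = v
  · fin_cases i <;> simp [weight, h]
  · simp [weight, h]

/-- If the lattices along a one-parameter orbit that expands the `i`-th coordinate at `v` have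
arbitrarily short vectors, then `K²` has a vector on which the `i`-th row of `g_v` vanishes.
Short vectors at the same time are proportional, so that their line is a locally constant function
of time; hence a single line carries all of them. -/
theorem exists_vec_eq_zero_of_short (g : G K) (v : InfinitePlace K) (i : Fin 2)
    (h : ∀ ε : ℝ, 0 < ε → ∃ S : ℝ, ∀ s ≥ S, ∃ w : Fin 2 → 𝓞 K, w ≠ 0 ∧
      ∀ u j, Real.exp (s * weight v i u j) * ‖vec g w u j‖ < ε) :
    ∃ w : Fin 2 → 𝓞 K, w ≠ 0 ∧ vec g w v i = 0 := by
  have hcross : ∀ (s : ℝ) (w w' : Fin 2 → 𝓞 K),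
      (∀ u j, Real.exp (s * weight v i u j) * ‖vec g w u j‖ < 1 / 2) →
      (∀ u j, Real.exp (s * weight v i u j) * ‖vec g w' u j‖ < 1 / 2) → cross w w' = 0 := by
    intro s w w' hw hw'
    refine eq_zero_of_norm_emb_lt_one fun u => ?_
    have hexp : Real.exp (s * weight v i u 0) * Real.exp (s * weight v i u 1) = 1 := by
      rw [← Real.exp_add, ← mul_add, weight_add, mul_zero, Real.exp_zero]
    have h1 : ‖vec g w u 0‖ * ‖vec g w' u 1‖ < 1 / 2 * (1 / 2) := by
      calc ‖vec g w u 0‖ * ‖vec g w' u 1‖ = (Real.exp (s * weight v i u 0) * ‖vec g w u 0‖) *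
            (Real.exp (s * weight v i u 1) * ‖vec g w' u 1‖) := by
            linear_combination (-‖vec g w u 0‖ * ‖vec g w' u 1‖) * hexp
        _ < _ := mul_lt_mul'' (hw u 0) (hw' u 1) (by positivity) (by positivity)
    have h2 : ‖vec g w u 1‖ * ‖vec g w' u 0‖ < 1 / 2 * (1 / 2) := by
      calc ‖vec g w u 1‖ * ‖vec g w' u 0‖ = (Real.exp (s * weight v i u 1) * ‖vec g w u 1‖) *
            (Real.exp (s * weight v i u 0) * ‖vec g w' u 0‖) := by
            linear_combination (-‖vec g w u 1‖ * ‖vec g w' u 0‖) * hexp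
        _ < _ := mul_lt_mul'' (hw u 1) (hw' u 0) (by positivity) (by positivity)
    rw [← cross_vec g, cross]
    refine (norm_sub_le _ _).trans_lt ?_
    rw [norm_mul, norm_mul]
    linarith
  obtain ⟨S, hS⟩ := h (1 / 2) (by norm_num)
  choose w hw0 hw using fun s : ℝ => hS (max S s) (le_max_left S s)
  have hconst : IsLocallyConstant fun s => cross (w S) (w s) = 0 := by
    rw [IsLocallyConstant.iff_eventually_eq]
    intro s
    have hev : ∀ᶠ t in 𝓝 s, ∀ u j,
        Real.exp (max S t * weight v i u j) * ‖vec g (w s) u j‖ < 1 / 2 := by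
      refine eventually_all.2 fun u => eventually_all.2 fun j => ?_
      have hc : Continuous fun t => Real.exp (max S t * weight v i u j) * ‖vec g (w s) u j‖ := by
        fun_prop
      exact (hc.tendsto s).eventually_lt_const (hw s u j)
    filter_upwards [hev] with t ht
    have hst : cross (w s) (w t) = 0 := hcross _ _ _ ht (hw t)
    exact propext ⟨fun h => cross_eq_zero_trans (hw0 t) h (cross_comm_eq_zero hst),
      fun h => cross_eq_zero_trans (hw0 s) h hst⟩
  have hline : ∀ s ≥ S, ∀ w' : Fin 2 → 𝓞 K,
      (∀ u j, Real.exp (s * weight v i u j) * ‖vec g w' u j‖ < 1 / 2) → cross (w S) w' = 0 := by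
    intro s hs w' hw'
    have h1 : cross (w S) (w s) = 0 := by
      rw [hconst.apply_eq_of_isPreconnected isPreconnected_univ (Set.mem_univ s) (Set.mem_univ S)]
      simp only [cross]
      ring
    have h2 := hw s
    rw [max_eq_right hs] at h2
    exact cross_eq_zero_trans (hw0 s) h1 (hcross s _ _ h2 hw')
  refine ⟨w S, hw0 S, ?_⟩
  by_contra hne
  obtain ⟨k, hk⟩ := Function.ne_iff.1 (hw0 S)
  -- the vectors on the line of `w S` are not shorter than a multiple of `m`
  have hm : ∀ u, ∃ m : ℝ, 0 < m ∧ ∀ s ≥ 0, ∃ j,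
      m ≤ Real.exp (s * weight v i u j) * ‖vec g (w S) u j‖ := fun u => by
    by_cases hu : u = v
    · subst hu
      refine ⟨‖vec g (w S) u i‖, norm_pos_iff.2 hne, fun s hs => ⟨i, ?_⟩⟩
      rw [weight_self, mul_one]
      exact le_mul_of_one_le_left (norm_nonneg _) (Real.one_le_exp hs)
    · obtain ⟨j, hj⟩ := Function.ne_iff.1 (vec_ne_zero g (hw0 S) u)
      refine ⟨‖vec g (w S) u j‖, norm_pos_iff.2 hj, fun s _ => ⟨j, ?_⟩⟩
      rw [weight_of_ne hu, mul_zero, Real.exp_zero, one_mul]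
  choose m hm0 hm using hm
  obtain ⟨ε, hε, hε2, hεm⟩ : ∃ ε : ℝ, 0 < ε ∧ ε ≤ 1 / 2 ∧ ∀ u, ‖emb u (w S k)‖ * ε ≤ m u := by
    have h1 : ∀ᶠ ε in 𝓝[>] (0 : ℝ), ∀ u, ‖emb u (w S k)‖ * ε ≤ m u := by
      refine eventually_all.2 fun u => ?_
      have hc : Tendsto (fun ε : ℝ => ‖emb u (w S k)‖ * ε) (𝓝[>] 0) (𝓝 0) := by
        have : Continuous fun ε : ℝ => ‖emb u (w S k)‖ * ε := by fun_prop
        simpa using (this.tendsto 0).mono_left nhdsWithin_le_nhds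
      exact (hc.eventually_lt_const (hm0 u)).mono fun _ h => h.le
    have h2 : ∀ᶠ ε in 𝓝[>] (0 : ℝ), ε ≤ 1 / 2 :=
      nhdsWithin_le_nhds (eventually_le_nhds (by norm_num))
    obtain ⟨ε, h1, h2, h3⟩ := (h1.and (h2.and self_mem_nhdsWithin)).exists
    exact ⟨ε, h3, h2, h1⟩
  obtain ⟨S', hS'⟩ := h ε hε
  let s := max (max S S') 0
  obtain ⟨w', hw'0, hw'⟩ := hS' s ((le_max_right _ _).trans (le_max_left _ _))
  have hpar : cross (w S) w' = 0 := hline s ((le_max_left _ _).trans (le_max_left _ _)) w'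
    fun u j => (hw' u j).trans_le hε2
  have hprop : ∀ j, w S k * w' j = w' k * w S j := fun j => by
    simp only [cross] at hpar
    fin_cases k <;> fin_cases j
    · exact mul_comm _ _
    · change w S 0 * w' 1 = w' 0 * w S 1
      linear_combination hpar
    · change w S 1 * w' 0 = w' 1 * w S 0
      linear_combination -hpar
    · exact mul_comm _ _
  have hw'k : w' k = 0 := eq_zero_of_norm_emb_lt_one fun u => by
    obtain ⟨j, hj⟩ := hm u s (le_max_right _ _)
    have hvec : emb u (w S k) * vec g w' u j = emb u (w' k) * vec g (w S) u j := by
      have h0 := congrArg (emb u) (hprop 0)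
      have h1 := congrArg (emb u) (hprop 1)
      simp only [map_mul] at h0 h1
      simp only [vec]
      linear_combination g u j 0 * h0 + g u j 1 * h1
    have hn := congrArg norm hvec
    rw [norm_mul, norm_mul] at hn
    have h1 : ‖emb u (w' k)‖ * m u < m u := by
      calc ‖emb u (w' k)‖ * m u
          ≤ ‖emb u (w' k)‖ * (Real.exp (s * weight v i u j) * ‖vec g (w S) u j‖) := by gcongr
        _ = ‖emb u (w S k)‖ * (Real.exp (s * weight v i u j) * ‖vec g w' u j‖) := by
            linear_combination (-Real.exp (s * weight v i u j)) * hn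
        _ < ‖emb u (w S k)‖ * ε := by
            have := norm_pos_iff.2 (emb_ne_zero u hk)
            gcongr
            exact hw' u j
        _ ≤ m u := hεm u
    exact (mul_lt_iff_lt_one_left (hm0 u)).1 h1
  refine hw'0 (funext fun j => (mul_eq_zero.1 ?_).resolve_left hk)
  rw [hprop, hw'k, zero_mul]

/-- The direction in the Lie algebra of `D_v` that expands the `i`-th coordinate. -/
noncomputable def direction (v : InfinitePlace K) (i : Fin 2) (s : ℝ) : InfinitePlace K → ℂ :=
  open scoped Classical in Pi.single v ((s * (if i = 0 then 1 else -1) : ℝ) : ℂ)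

omit [NumberField K] in
theorem direction_mem_lieDR (v : InfinitePlace K) (i : Fin 2) (s : ℝ) :
    direction v i s ∈ lieDR {v} := by
  classical
  refine ⟨fun u hu => ?_, fun u => ?_⟩
  · rw [direction, Pi.single_eq_of_ne (by simpa using hu)]
  · by_cases h : u = v
    · subst h
      rw [direction, Pi.single_eq_same, Complex.ofReal_im]
    · rw [direction, Pi.single_eq_of_ne h, Complex.zero_im]

theorem norm_diagExp_direction (v : InfinitePlace K) (i : Fin 2) (s : ℝ) (u : InfinitePlace K)
    (j : Fin 2) : ‖diagExp (direction v i s) u j j‖ = Real.exp (s * weight v i u j) := by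
  classical
  by_cases h : u = v
  · subst h
    have hs : diagExp (direction u i s) u =
        d u (expUnit u (s * (if i = 0 then 1 else -1) : ℝ)) := by
      rw [diagExp, direction, Pi.single_eq_same]
    rw [hs]
    fin_cases j
    · refine (norm_expUnit_ofReal u _).trans ?_
      fin_cases i <;> simp [weight]
    · refine (congrArg norm (congrArg Units.val (expUnit_neg u _).symm)).trans ?_
      rw [← Complex.ofReal_neg, norm_expUnit_ofReal]
      fin_cases i <;> simp [weight]
  · rw [diagExp_apply_eq_one (by rw [direction, Pi.single_eq_of_ne h]), weight_of_ne h]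
    fin_cases j <;> simp

theorem norm_vec_diagExp_mul (s : InfinitePlace K → ℂ) (g : G K) (w : Fin 2 → 𝓞 K)
    (u : InfinitePlace K) (j : Fin 2) :
    ‖vec (diagExp s * g) w u j‖ = ‖diagExp s u j j‖ * ‖vec g w u j‖ := by
  rw [vec_mul, ← norm_mul]
  congr 1
  fin_cases j
  · change diagExp s u 0 0 * _ + 0 * _ = _
    rw [zero_mul, add_zero]
    rfl
  · change 0 * _ + diagExp s u 1 1 * _ = _
    rw [zero_mul, zero_add]
    rfl

/-- If `H π(g)` is divergent, where `H` contains `D_{v,ℝ}`, then the rows of `g_v` are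
proportional to rows with entries in `K`. -/
theorem exists_vec_eq_zero_of_isDivergent {H : Subgroup (G K)} {v : InfinitePlace K}
    (hH : DR {v} ≤ H) {g : G K} (hg : IsDivergent H (π g)) (i : Fin 2) :
    ∃ w : Fin 2 → 𝓞 K, w ≠ 0 ∧ vec g w v i = 0 := by
  refine exists_vec_eq_zero_of_short g v i fun ε hε => ?_
  have hmem : ∀ s, diagExp (direction v i s) ∈ H := fun s => hH <| by
    rw [← SetLike.mem_coe, coe_DR]
    exact ⟨_, direction_mem_lieDR v i s, rfl⟩
  have htend : Tendsto (fun s => (⟨diagExp (direction v i s), hmem s⟩ : H)) atTop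
      (cocompact H) := by
    refine (hasBasis_cocompact.tendsto_right_iff).2 fun C hC => ?_
    have hcont : Continuous fun h : H => ‖(h : G K) v i i‖ :=
      ((continuous_entry v i i).comp continuous_subtype_val).norm
    obtain ⟨B, hB⟩ := (hC.image hcont).bddAbove
    filter_upwards [(Real.tendsto_exp_atTop.eventually_gt_atTop B)] with s hs hsC
    have : ‖diagExp (direction v i s) v i i‖ ≤ B := hB ⟨_, hsC, rfl⟩
    rw [norm_diagExp_direction, weight_self, mul_one] at this
    exact absurd hs (not_lt.2 this)
  obtain ⟨C, hC, hCw⟩ := exists_isCompact_forall_notMem (K := K) hε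
  obtain ⟨S, hS⟩ := eventually_atTop.1 ((hg.comp htend).eventually hC.compl_mem_cocompact)
  refine ⟨S, fun s hs => ?_⟩
  obtain ⟨w, hw, hws⟩ := hCw (diagExp (direction v i s) * g) (hS s hs)
  refine ⟨w, hw, fun u j => ?_⟩
  rw [← norm_diagExp_direction, ← norm_vec_diagExp_mul]
  exact hws u j

end

/-! ### Sequences of integral vectors -/

section

variable {K : Type*} [Field K] [NumberField K]

theorem one_le_prod_of_norm_emb_le {r : Fin 2 → 𝓞 K} (hr : r ≠ 0) {f : InfinitePlace K → ℝ}
    (hf : ∀ v k, ‖emb v (r k)‖ ≤ f v) : 1 ≤ ∏ v, f v ^ v.mult := by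
  obtain ⟨k, hk⟩ := Function.ne_iff.1 hr
  exact (one_le_prod_norm_emb hk).trans (Finset.prod_le_prod (fun v _ => by positivity)
    fun v _ => pow_le_pow_left₀ (norm_nonneg _) (hf v k) _)

theorem norm_le_norm_add_norm {E : Type*} [SeminormedAddCommGroup E] (y : Fin 2 → E) (k : Fin 2) :
    ‖y k‖ ≤ ‖y 0‖ + ‖y 1‖ := by
  fin_cases k
  · exact le_add_of_nonneg_right (norm_nonneg _)
  · exact le_add_of_nonneg_left (norm_nonneg _)

/-- Nonzero integral vectors that stay bounded at all places do not tend to zero at one of them. -/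
theorem false_of_tendsto_zero_of_bounded {α : Type*} {l : Filter α} [l.NeBot]
    {r : α → Fin 2 → 𝓞 K} (hr : ∀ n, r n ≠ 0) (v₁ : InfinitePlace K)
    (h₁ : ∀ k, Tendsto (fun n => emb v₁ (r n k)) l (𝓝 0))
    (h : ∀ v ≠ v₁, ∃ B : ℝ, ∀ᶠ n in l, ∀ k, ‖emb v (r n k)‖ ≤ B) : False := by
  classical
  choose! B hB using h
  let f : InfinitePlace K → α → ℝ := fun v n =>
    if v = v₁ then ‖emb v (r n 0)‖ + ‖emb v (r n 1)‖ else B v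
  have hlim : Tendsto (fun n => ∏ v, f v n ^ v.mult) l
      (𝓝 (∏ v : InfinitePlace K, (if v = v₁ then 0 else B v) ^ v.mult)) := by
    refine tendsto_finsetProd _ fun v _ => Tendsto.pow ?_ _
    by_cases hv : v = v₁
    · subst hv
      simpa [f] using (h₁ 0).norm.add (h₁ 1).norm
    · simp [f, hv]
  rw [Finset.prod_eq_zero (Finset.mem_univ v₁) (by simp [v₁.mult_ne_zero])] at hlim
  have hev : ∀ᶠ n in l, 1 ≤ ∏ v, f v n ^ v.mult := by
    have : ∀ᶠ n in l, ∀ v, v ≠ v₁ → ∀ k, ‖emb v (r n k)‖ ≤ B v :=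
      eventually_all.2 fun v => by
        by_cases hv : v = v₁
        · exact Eventually.of_forall fun n h => absurd hv h
        · exact (hB v hv).mono fun n hn _ => hn
    filter_upwards [this] with n hn
    refine one_le_prod_of_norm_emb_le (hr n) fun v k => ?_
    by_cases hv : v = v₁
    · simp only [f, if_pos hv]
      exact norm_le_norm_add_norm (fun k => emb v (r n k)) k
    · simp only [f, if_neg hv]
      exact hn v hv k
  obtain ⟨n, h1, h2⟩ := (hev.and (hlim.eventually_lt_const one_pos)).exists
  exact absurd h1 (not_le.2 h2)

/-- If nonzero integral vectors converge after a rescaling, then the norm of the scaling factors is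
bounded. -/
theorem exists_prod_norm_le_of_tendsto {α : Type*} {l : Filter α} {r : α → Fin 2 → 𝓞 K}
    (hr : ∀ n, r n ≠ 0) {σ : ∀ v : InfinitePlace K, α → v.Completion}
    {y : ∀ v : InfinitePlace K, Fin 2 → v.Completion}
    (h : ∀ v k, Tendsto (fun n => σ v n * emb v (r n k)) l (𝓝 (y v k))) :
    ∃ C : ℝ, 0 < C ∧ ∀ᶠ n in l, ∏ v, ‖σ v n‖ ^ v.mult ≤ C := by
  refine ⟨∏ v, (‖y v 0‖ + ‖y v 1‖ + 1) ^ v.mult,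
    Finset.prod_pos fun v _ => by positivity, ?_⟩
  have : ∀ᶠ n in l, ∀ v k, ‖σ v n * emb v (r n k)‖ ≤ ‖y v 0‖ + ‖y v 1‖ + 1 :=
    eventually_all.2 fun v => eventually_all.2 fun k =>
      ((h v k).norm.eventually_lt_const ((norm_le_norm_add_norm (y v) k).trans_lt
        (lt_add_one _))).mono fun _ h => h.le
  filter_upwards [this] with n hn
  obtain ⟨k, hk⟩ := Function.ne_iff.1 (hr n)
  calc ∏ v, ‖σ v n‖ ^ v.mult
      ≤ (∏ v, ‖σ v n‖ ^ v.mult) * ∏ v : InfinitePlace K, ‖emb v (r n k)‖ ^ v.mult :=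
        le_mul_of_one_le_right (Finset.prod_nonneg fun v _ => by positivity)
          (one_le_prod_norm_emb hk)
    _ = ∏ v, ‖σ v n * emb v (r n k)‖ ^ v.mult := by
        rw [← Finset.prod_mul_distrib]
        exact Finset.prod_congr rfl fun v _ => by rw [norm_mul, mul_pow]
    _ ≤ _ := Finset.prod_le_prod (fun v _ => by positivity)
        fun v _ => pow_le_pow_left₀ (norm_nonneg _) (hn v k) _

/-- If integral vectors converge after a rescaling by factors whose norm is bounded below, then
they are eventually proportional to each other: the norm of the determinant of two of them tends
to zero. -/
theorem eventually_cross_eq_zero_of_tendsto {α : Type*} {l : Filter α} {r : α → Fin 2 → 𝓞 K}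
    {σ : ∀ v : InfinitePlace K, α → v.Completion}
    {y : ∀ v : InfinitePlace K, Fin 2 → v.Completion}
    (h : ∀ v k, Tendsto (fun n => σ v n * emb v (r n k)) l (𝓝 (y v k)))
    {c : ℝ} (hc : 0 < c) (hσ : ∀ᶠ n in l, c ≤ ∏ v, ‖σ v n‖ ^ v.mult) :
    ∀ᶠ p in l ×ˢ l, cross (r p.1) (r p.2) = 0 := by
  have hv : ∀ v, Tendsto (fun p : α × α => σ v p.1 * σ v p.2 * emb v (cross (r p.1) (r p.2)))
      (l ×ˢ l) (𝓝 0) := fun v => by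
    have h1 := fun k => (h v k).comp (tendsto_fst (f := l) (g := l))
    have h2 := fun k => (h v k).comp (tendsto_snd (f := l) (g := l))
    have h3 := ((h1 0).mul (h2 1)).sub ((h1 1).mul (h2 0))
    rw [mul_comm (y v 1), sub_self] at h3
    refine h3.congr fun p => ?_
    simp only [Function.comp, cross, map_sub, map_mul]
    ring
  have hprod : Tendsto (fun p : α × α => ∏ v,
      ‖σ v p.1 * σ v p.2 * emb v (cross (r p.1) (r p.2))‖ ^ v.mult) (l ×ˢ l) (𝓝 0) := by
    obtain ⟨v₀⟩ := (inferInstance : Nonempty (InfinitePlace K))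
    have := tendsto_finsetProd Finset.univ
      fun (v : InfinitePlace K) _ => (hv v).norm.pow v.mult
    rwa [Finset.prod_eq_zero (Finset.mem_univ v₀) (by simp [v₀.mult_ne_zero])] at this
  filter_upwards [hprod.eventually_lt_const (mul_pos hc hc), tendsto_fst.eventually hσ,
    tendsto_snd.eventually hσ] with p hp h1 h2
  by_contra hne
  refine absurd hp (not_lt.2 ?_)
  simp only [norm_mul, mul_pow, Finset.prod_mul_distrib]
  calc c * c ≤ (∏ v, ‖σ v p.1‖ ^ v.mult) * ∏ v, ‖σ v p.2‖ ^ v.mult :=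
        mul_le_mul h1 h2 hc.le (hc.le.trans h1)
    _ ≤ _ := le_mul_of_one_le_right
        (mul_nonneg (hc.le.trans h1) (hc.le.trans h2)) (one_le_prod_norm_emb hne)

/-! ### Limits of divergent sequences on a locally divergent orbit -/

/-- The row vector `r γ`. -/
def rowMul {R : Type*} [CommRing R] (r : Fin 2 → R) (γ : Matrix.SpecialLinearGroup (Fin 2) R) :
    Fin 2 → R :=
  fun k => r 0 * γ 0 k + r 1 * γ 1 k

theorem rowMul_ne_zero {R : Type*} [CommRing R] {r : Fin 2 → R} (hr : r ≠ 0)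
    (γ : Matrix.SpecialLinearGroup (Fin 2) R) : rowMul r γ ≠ 0 := by
  intro h
  have h0 := congrFun h 0
  have h1 := congrFun h 1
  have hd := det_coe_two γ
  simp only [rowMul, Pi.zero_apply] at h0 h1
  refine hr (funext fun k => ?_)
  fin_cases k
  · change r 0 = 0
    linear_combination γ 1 1 * h0 - γ 1 0 * h1 - r 0 * hd
  · change r 1 = 0
    linear_combination γ 0 0 * h1 - γ 0 1 * h0 - r 1 * hd

/-- Cramer's rule for the rows `r γ`. -/
theorem cross_mul_rowMul {R : Type*} [CommRing R] (a b r : Fin 2 → R)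
    (γ : Matrix.SpecialLinearGroup (Fin 2) R) (k : Fin 2) :
    cross a b * rowMul r γ k = cross r b * rowMul a γ k + cross a r * rowMul b γ k := by
  simp only [cross, rowMul]
  ring

theorem mul_diagEmb_apply (g : G K) (γ : Matrix.SpecialLinearGroup (Fin 2) (𝓞 K))
    (v : InfinitePlace K) (i j : Fin 2) :
    (g * diagEmb K γ) v i j = g v i 0 * emb v (γ 0 j) + g v i 1 * emb v (γ 1 j) := by
  simp only [Pi.mul_apply, Matrix.SpecialLinearGroup.coe_mul, Matrix.mul_apply,
    Fin.sum_univ_two, diagEmb_apply]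

theorem G_mul_apply (g h : G K) (v : InfinitePlace K) (i j : Fin 2) :
    (g * h) v i j = g v i 0 * h v 0 j + g v i 1 * h v 1 j := by
  simp only [Pi.mul_apply, Matrix.SpecialLinearGroup.coe_mul, Matrix.mul_apply, Fin.sum_univ_two]

theorem G_inv_apply (g : G K) (v : InfinitePlace K) :
    g⁻¹ v 0 0 = g v 1 1 ∧ g⁻¹ v 0 1 = -g v 0 1 ∧ g⁻¹ v 1 0 = -g v 1 0 ∧ g⁻¹ v 1 1 = g v 0 0 := by
  simp [Matrix.SpecialLinearGroup.coe_inv, Matrix.adjugate_fin_two]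

/-- A row of `g_v` that annihilates a nonzero integral vector is a multiple of an integral row. -/
theorem exists_row_eq_smul {g : G K} {v : InfinitePlace K} {i : Fin 2} {w : Fin 2 → 𝓞 K}
    (hw : w ≠ 0) (h : vec g w v i = 0) :
    ∃ r : Fin 2 → 𝓞 K, r ≠ 0 ∧ ∃ c : v.Completion, c ≠ 0 ∧ ∀ k, g v i k = c * emb v (r k) := by
  have hr : (![w 1, -w 0] : Fin 2 → 𝓞 K) ≠ 0 := by
    intro h0
    have e0 : w 1 = 0 := congrFun h0 0
    have e1 : -w 0 = 0 := congrFun h0 1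
    refine hw (funext fun k => ?_)
    fin_cases k
    exacts [neg_eq_zero.1 e1, e0]
  obtain ⟨c, hc⟩ : ∃ c : v.Completion, ∀ k,
      g v i k = c * emb v ((![w 1, -w 0] : Fin 2 → 𝓞 K) k) := by
    simp only [vec] at h
    by_cases h0 : w 0 = 0
    · have h1 : w 1 ≠ 0 := fun h1 => hw (funext fun k => by fin_cases k <;> assumption)
      have hne := emb_ne_zero v h1
      rw [h0, map_zero, mul_zero, zero_add] at h
      have h2 := (mul_eq_zero.1 h).resolve_right hne
      refine ⟨g v i 0 / emb v (w 1), fun k => ?_⟩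
      fin_cases k
      · exact (div_mul_cancel₀ _ hne).symm
      · change g v i 1 = _ * emb v (-w 0)
        rw [h0, h2, neg_zero, map_zero, mul_zero]
    · have hne := emb_ne_zero v h0
      refine ⟨-(g v i 1 / emb v (w 0)), fun k => ?_⟩
      fin_cases k
      · change g v i 0 = _ * emb v (w 1)
        field_simp
        linear_combination h
      · change g v i 1 = _ * emb v (-w 0)
        rw [map_neg, neg_mul_neg, div_mul_cancel₀ _ hne]
  refine ⟨_, hr, c, ?_, hc⟩
  rintro rfl
  have hd := det_coe_two (g v)
  have e0 := hc 0
  have e1 := hc 1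
  rw [zero_mul] at e0 e1
  fin_cases i
  · change g v 0 0 = 0 at e0
    change g v 0 1 = 0 at e1
    simp [e0, e1] at hd
  · change g v 1 0 = 0 at e0
    change g v 1 1 = 0 at e1
    simp [e0, e1] at hd

/-- The full diagonal subgroup of `G`. -/
def diagSubgroup (K : Type*) [Field K] [NumberField K] : Subgroup (G K) where
  carrier := {a | ∀ v, a v 0 1 = 0 ∧ a v 1 0 = 0}
  mul_mem' ha hb v := by
    rw [G_mul_apply, G_mul_apply, (ha v).1, (ha v).2, (hb v).1, (hb v).2]
    simp
  one_mem' v := by simp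
  inv_mem' ha v := by
    rw [(G_inv_apply _ v).2.1, (G_inv_apply _ v).2.2.1, (ha v).1, (ha v).2]
    simp

theorem mem_diagSubgroup_iff {a : G K} :
    a ∈ diagSubgroup K ↔ ∀ v, a v 0 1 = 0 ∧ a v 1 0 = 0 := Iff.rfl

theorem isClosed_diagSubgroup : IsClosed (diagSubgroup K : Set (G K)) := by
  have : (diagSubgroup K : Set (G K)) = ⋂ v, {a : G K | a v 0 1 = 0} ∩ {a | a v 1 0 = 0} := by
    ext a; simp [mem_diagSubgroup_iff]
  rw [this]
  exact isClosed_iInter fun v => (isClosed_eq (continuous_entry v 0 1) continuous_const).inter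
    (isClosed_eq (continuous_entry v 1 0) continuous_const)

theorem diag_mul_apply {a : G K} (ha : a ∈ diagSubgroup K) (g : G K) (v : InfinitePlace K)
    (i j : Fin 2) : (a * g) v i j = a v i i * g v i j := by
  rw [G_mul_apply]
  fin_cases i
  · change a v 0 0 * _ + a v 0 1 * _ = a v 0 0 * g v 0 j
    rw [(ha v).1, zero_mul, add_zero]
  · change a v 1 0 * _ + a v 1 1 * _ = a v 1 1 * g v 1 j
    rw [(ha v).2, zero_mul, zero_add]

theorem diag_apply_mul_apply {a : G K} (ha : a ∈ diagSubgroup K) (v : InfinitePlace K)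
    {i j : Fin 2} (hij : i ≠ j) : a v i i * a v j j = 1 := by
  have hd := det_coe_two (a v)
  rw [(ha v).1, zero_mul, sub_zero] at hd
  fin_cases i <;> fin_cases j
  · exact absurd rfl hij
  · exact hd
  · exact (mul_comm _ _).trans hd
  · exact absurd rfl hij

/-- If the rows of `y` are proportional to those of `k`, then `y k⁻¹` is diagonal. -/
theorem mul_inv_mem_diagSubgroup {y k : G K}
    (h : ∀ v i, y v i 0 * k v i 1 - y v i 1 * k v i 0 = 0) : y * k⁻¹ ∈ diagSubgroup K := by
  intro v
  rw [G_mul_apply, G_mul_apply, (G_inv_apply k v).1, (G_inv_apply k v).2.1, (G_inv_apply k v).2.2.1,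
    (G_inv_apply k v).2.2.2]
  exact ⟨by linear_combination -h v 0, by linear_combination h v 1⟩

end

/-! ### Approximating sequences -/

section

variable {K : Type*} [Field K] [NumberField K]

/-- Integral rows `r i` whose multiples by `c i` are the rows of `g_v`: the form that local
divergence at `v` takes. -/
structure RationalRows (g : G K) (v : InfinitePlace K) where
  /-- The integral rows. -/
  r : Fin 2 → Fin 2 → 𝓞 K
  /-- The factors. -/
  c : Fin 2 → v.Completion
  r_ne : ∀ i, r i ≠ 0
  c_ne : ∀ i, c i ≠ 0
  eq : ∀ i k, g v i k = c i * emb v (r i k)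

/-- The points `t_n g γ_n` converge to `z`, where the `t_n` are diagonal and trivial outside the
places `v₁` and `v₂`. -/
structure Approach {α : Type*} (l : Filter α) (g z : G K) (v₁ v₂ : InfinitePlace K) (t : α → G K)
    (γ : α → Matrix.SpecialLinearGroup (Fin 2) (𝓞 K)) : Prop where
  diag : ∀ n, t n ∈ diagSubgroup K
  eq_one : ∀ n v, v ≠ v₁ → v ≠ v₂ → t n v = 1
  tendsto : Tendsto (fun n => t n * g * diagEmb K (γ n)) l (𝓝 z)

theorem RationalRows.cross_ne_zero {g : G K} {v : InfinitePlace K} (ρ : RationalRows g v)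
    {i j : Fin 2} (hij : i ≠ j) : cross (ρ.r i) (ρ.r j) ≠ 0 := by
  have h01 : cross (ρ.r 0) (ρ.r 1) ≠ 0 := by
    intro h
    have hd := det_coe_two (g v)
    rw [ρ.eq, ρ.eq, ρ.eq, ρ.eq] at hd
    have h' := congrArg (emb v) h
    simp only [cross, map_sub, map_mul, map_zero] at h'
    refine one_ne_zero (α := v.Completion) ?_
    rw [← hd]
    linear_combination ρ.c 0 * ρ.c 1 * h'
  fin_cases i <;> fin_cases j
  · exact absurd rfl hij
  · exact h01
  · exact fun h => h01 (cross_comm_eq_zero h)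
  · exact absurd rfl hij

section Approach

variable {α : Type*} {l : Filter α} {g z : G K} {v₁ v₂ v : InfinitePlace K} {t : α → G K}
  {γ : α → Matrix.SpecialLinearGroup (Fin 2) (𝓞 K)}

theorem Approach.tendsto_entry (A : Approach l g z v₁ v₂ t γ) (v : InfinitePlace K) (i k : Fin 2) :
    Tendsto (fun n => t n v i i * (g * diagEmb K (γ n)) v i k) l (𝓝 (z v i k)) := by
  refine (((continuous_entry v i k).tendsto z).comp A.tendsto).congr fun n => ?_
  change (t n * g * diagEmb K (γ n)) v i k = _
  rw [mul_assoc, diag_mul_apply (A.diag n)]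

theorem Approach.tendsto_row (A : Approach l g z v₁ v₂ t γ) (ρ : RationalRows g v) (i k : Fin 2) :
    Tendsto (fun n => t n v i i * emb v (rowMul (ρ.r i) (γ n) k)) l
      (𝓝 ((ρ.c i)⁻¹ * z v i k)) := by
  refine ((A.tendsto_entry v i k).const_mul (ρ.c i)⁻¹).congr fun n => ?_
  have := ρ.c_ne i
  rw [mul_diagEmb_apply, ρ.eq, ρ.eq]
  simp only [rowMul, map_add, map_mul]
  field_simp

/-- The integral vectors `r γ_n` converge at the places where `t_n` is trivial. -/
theorem Approach.tendsto_of_ne (A : Approach l g z v₁ v₂ t γ) (h₁ : v ≠ v₁) (h₂ : v ≠ v₂)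
    (r : Fin 2 → 𝓞 K) (k : Fin 2) :
    Tendsto (fun n => emb v (rowMul r (γ n) k)) l
      (𝓝 (emb v (r 0) * (g⁻¹ * z) v 0 k + emb v (r 1) * (g⁻¹ * z) v 1 k)) := by
  have h : ∀ i, Tendsto (fun n => emb v (γ n i k)) l (𝓝 ((g⁻¹ * z) v i k)) := fun i => by
    have h1 : Tendsto (fun n => g⁻¹ * (t n * g * diagEmb K (γ n))) l (𝓝 (g⁻¹ * z)) :=
      A.tendsto.const_mul _
    refine (((continuous_entry v i k).tendsto _).comp h1).congr fun n => ?_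
    have h2 : (g⁻¹ * (t n * g * diagEmb K (γ n))) v = diagEmb K (γ n) v := by
      simp only [Pi.mul_apply, Pi.inv_apply, A.eq_one n v h₁ h₂, one_mul, inv_mul_cancel_left]
    change (g⁻¹ * (t n * g * diagEmb K (γ n))) v i k = _
    rw [h2, diagEmb_apply]
  refine (((h 0).const_mul _).add ((h 1).const_mul _)).congr fun n => ?_
  simp only [rowMul, map_add, map_mul]

theorem Approach.tendsto_zero_of_expanded (A : Approach l g z v₁ v₂ t γ) {j j' : Fin 2}
    (hj : j ≠ j') (h : Tendsto (fun n => ‖t n v j j‖) l atTop) :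
    Tendsto (fun n => t n v j' j') l (𝓝 0) := by
  rw [tendsto_zero_iff_norm_tendsto_zero]
  refine h.inv_tendsto_atTop.congr fun n => ?_
  have := diag_apply_mul_apply (A.diag n) v hj
  rw [Pi.inv_apply, ← norm_inv, inv_eq_of_mul_eq_one_right this]

/-- The integral row that `t_n` expands tends to zero. -/
theorem Approach.tendsto_row_zero (A : Approach l g z v₁ v₂ t γ) (ρ : RationalRows g v) {j : Fin 2}
    (h : Tendsto (fun n => ‖t n v j j‖) l atTop) (k : Fin 2) :
    Tendsto (fun n => emb v (rowMul (ρ.r j) (γ n) k)) l (𝓝 0) := by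
  have hj : j ≠ 1 - j := by fin_cases j <;> decide
  have := (A.tendsto_zero_of_expanded hj h).mul (A.tendsto_row ρ j k)
  rw [zero_mul] at this
  refine this.congr fun n => ?_
  have h1 := diag_apply_mul_apply (A.diag n) v hj
  rw [← mul_assoc, mul_comm (t n v (1 - j) (1 - j)), h1, one_mul]

/-- Every integral row converges after a rescaling by the contracting eigenvalue of `t_n`. -/
theorem Approach.exists_tendsto_contracted (A : Approach l g z v₁ v₂ t γ) (ρ : RationalRows g v)
    {j j' : Fin 2} (hj : j ≠ j') (h : Tendsto (fun n => ‖t n v j j‖) l atTop) (r : Fin 2 → 𝓞 K)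
    (k : Fin 2) :
    ∃ y, Tendsto (fun n => t n v j' j' * emb v (rowMul r (γ n) k)) l (𝓝 y) := by
  have hD := emb_ne_zero v (ρ.cross_ne_zero hj)
  have h1 := (A.tendsto_zero_of_expanded hj h).mul (A.tendsto_row_zero ρ h k)
  have h2 := (h1.const_mul (emb v (cross r (ρ.r j')))).add
    ((A.tendsto_row ρ j' k).const_mul (emb v (cross (ρ.r j) r)))
  refine ⟨_, (h2.const_mul (emb v (cross (ρ.r j) (ρ.r j')))⁻¹).congr fun n => ?_⟩
  have h3 := congrArg (emb v) (cross_mul_rowMul (ρ.r j) (ρ.r j') r (γ n) k)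
  rw [map_mul, map_add, map_mul, map_mul] at h3
  rw [inv_mul_eq_iff_eq_mul₀ hD]
  linear_combination (-t n v j' j') * h3

/-- The expanding directions at `v₁` and at `v₂` do not come from the same line of `K²`. -/
theorem Approach.cross_ne_zero [l.NeBot] (A : Approach l g z v₁ v₂ t γ) (hv : v₁ ≠ v₂)
    (ρ₁ : RationalRows g v₁) (ρ₂ : RationalRows g v₂) {j₁ j₂ : Fin 2}
    (h₁ : Tendsto (fun n => ‖t n v₁ j₁ j₁‖) l atTop)
    (h₂ : Tendsto (fun n => ‖t n v₂ j₂ j₂‖) l atTop) : cross (ρ₁.r j₁) (ρ₂.r j₂) ≠ 0 := by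
  intro h0
  refine false_of_tendsto_zero_of_bounded (fun n => rowMul_ne_zero (ρ₁.r_ne j₁) (γ n)) v₁
    (A.tendsto_row_zero ρ₁ h₁) fun v hv₁ => ?_
  have hconv : ∀ k, ∃ y, Tendsto (fun n => emb v (rowMul (ρ₁.r j₁) (γ n) k)) l (𝓝 y) := fun k => by
    by_cases hv₂ : v = v₂
    · subst hv₂
      obtain ⟨i, hi⟩ := Function.ne_iff.1 (ρ₂.r_ne j₂)
      have hne := emb_ne_zero v hi
      have h1 := (A.tendsto_row_zero ρ₂ h₂ k).const_mul
        ((emb v (ρ₂.r j₂ i))⁻¹ * emb v (ρ₁.r j₁ i))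
      refine ⟨_, h1.congr fun n => ?_⟩
      have h2 : ρ₂.r j₂ i * rowMul (ρ₁.r j₁) (γ n) k = ρ₁.r j₁ i * rowMul (ρ₂.r j₂) (γ n) k := by
        simp only [cross] at h0
        simp only [rowMul]
        fin_cases i
        · change ρ₂.r j₂ 0 * _ = ρ₁.r j₁ 0 * _
          linear_combination (-γ n 1 k) * h0
        · change ρ₂.r j₂ 1 * _ = ρ₁.r j₁ 1 * _
          linear_combination (γ n 0 k) * h0
      have h3 := congrArg (emb v) h2
      rw [map_mul, map_mul] at h3
      rw [mul_assoc, inv_mul_eq_iff_eq_mul₀ hne, h3]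
    · exact ⟨_, A.tendsto_of_ne hv₁ hv₂ _ k⟩
  choose y hy using hconv
  refine ⟨‖y 0‖ + ‖y 1‖ + 1, eventually_all.2 fun k => ?_⟩
  exact ((hy k).norm.eventually_lt_const
    ((norm_le_norm_add_norm y k).trans_lt (lt_add_one _))).mono fun _ h => h.le

/-- Where `t_n` stays bounded, so does `γ_n`. -/
theorem Approach.exists_norm_emb_le (A : Approach l g z v₁ v₂ t γ) {B : ℝ}
    (h : ∀ᶠ n in l, ∀ i, ‖t n v i i‖ ≤ B) :
    ∃ B' : ℝ, ∀ᶠ n in l, ∀ i k, ‖emb v (γ n i k)‖ ≤ B' := by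
  let M := ∑ i, ∑ k, B * (‖z v i k‖ + 1)
  let N := ∑ i, ∑ k, ‖g⁻¹ v i k‖
  refine ⟨N * M + N * M, ?_⟩
  have hz : ∀ᶠ n in l, ∀ i k, ‖t n v i i * (g * diagEmb K (γ n)) v i k‖ ≤ ‖z v i k‖ + 1 :=
    eventually_all.2 fun i => eventually_all.2 fun k =>
      ((A.tendsto_entry v i k).norm.eventually_lt_const (lt_add_one _)).mono fun _ h => h.le
  filter_upwards [h, hz] with n hn hzn i k
  have hB : 0 ≤ B := (norm_nonneg _).trans (hn 0)
  have h1 : ∀ i k, ‖(g * diagEmb K (γ n)) v i k‖ ≤ M := fun i k => by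
    have hne : i ≠ 1 - i := by fin_cases i <;> decide
    have h2 := diag_apply_mul_apply (A.diag n) v hne
    calc ‖(g * diagEmb K (γ n)) v i k‖
        = ‖t n v (1 - i) (1 - i)‖ * ‖t n v i i * (g * diagEmb K (γ n)) v i k‖ := by
          rw [← norm_mul, ← mul_assoc, mul_comm (t n v (1 - i) (1 - i)), h2, one_mul]
      _ ≤ B * (‖z v i k‖ + 1) := mul_le_mul (hn _) (hzn i k) (norm_nonneg _) hB
      _ ≤ ∑ k, B * (‖z v i k‖ + 1) := Finset.single_le_sum
          (f := fun k => B * (‖z v i k‖ + 1)) (fun _ _ => by positivity) (Finset.mem_univ k)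
      _ ≤ M := Finset.single_le_sum (f := fun i => ∑ k, B * (‖z v i k‖ + 1))
          (fun _ _ => by positivity) (Finset.mem_univ i)
  have hN : ∀ i k, ‖g⁻¹ v i k‖ ≤ N := fun i k =>
    (Finset.single_le_sum (f := fun k => ‖g⁻¹ v i k‖) (fun _ _ => norm_nonneg _)
      (Finset.mem_univ k)).trans (Finset.single_le_sum (f := fun i => ∑ k, ‖g⁻¹ v i k‖)
        (fun _ _ => by positivity) (Finset.mem_univ i))
  have hM : 0 ≤ N := (norm_nonneg _).trans (hN 0 0)
  rw [← diagEmb_apply, ← inv_mul_cancel_left g (diagEmb K (γ n)), G_mul_apply]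
  refine (norm_add_le _ _).trans (add_le_add ?_ ?_) <;>
  · rw [norm_mul]
    exact mul_le_mul (hN _ _) (h1 _ _) (norm_nonneg _) hM

theorem Approach.norm_le_one_of_ne (A : Approach l g z v₁ v₂ t γ) (h₁ : v ≠ v₁) (h₂ : v ≠ v₂) :
    ∀ᶠ n in l, ∀ i, ‖t n v i i‖ ≤ 1 := by
  refine Eventually.of_forall fun n i => ?_
  rw [A.eq_one n v h₁ h₂]
  fin_cases i <;> simp

/-- The sequence `t_n` cannot diverge at `v₁` and stay bounded at `v₂`. -/
theorem Approach.false_of_bounded [l.NeBot] (A : Approach l g z v₁ v₂ t γ)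
    (ρ₁ : RationalRows g v₁) {j : Fin 2} (h₁ : Tendsto (fun n => ‖t n v₁ j j‖) l atTop)
    {B : ℝ} (h₂ : ∀ᶠ n in l, ∀ i, ‖t n v₂ i i‖ ≤ B) : False := by
  refine false_of_tendsto_zero_of_bounded (fun n => rowMul_ne_zero (ρ₁.r_ne j) (γ n)) v₁
    (A.tendsto_row_zero ρ₁ h₁) fun v hv₁ => ?_
  obtain ⟨B', hB'⟩ : ∃ B' : ℝ, ∀ᶠ n in l, ∀ i k, ‖emb v (γ n i k)‖ ≤ B' := by
    by_cases hv₂ : v = v₂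
    · subst hv₂
      exact A.exists_norm_emb_le h₂
    · exact A.exists_norm_emb_le (A.norm_le_one_of_ne hv₁ hv₂)
  refine ⟨‖emb v (ρ₁.r j 0)‖ * B' + ‖emb v (ρ₁.r j 1)‖ * B', hB'.mono fun n hn k => ?_⟩
  simp only [rowMul, map_add, map_mul]
  refine (norm_add_le _ _).trans (add_le_add ?_ ?_) <;>
  · rw [norm_mul]
    exact mul_le_mul_of_nonneg_left (hn _ _) (norm_nonneg _)

/-- If `t_n` stays bounded at both places, then the limit lies on the orbit of the diagonal
group. -/
theorem Approach.exists_eq_of_bounded {l : Ultrafilter α} (A : Approach l g z v₁ v₂ t γ) {B : ℝ}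
    (h₁ : ∀ᶠ n in l, ∀ i, ‖t n v₁ i i‖ ≤ B) (h₂ : ∀ᶠ n in l, ∀ i, ‖t n v₂ i i‖ ≤ B) :
    ∃ a ∈ diagSubgroup K, ∃ γ₀, z = a * g * diagEmb K γ₀ := by
  have hb : ∀ v, ∃ B' : ℝ, ∀ᶠ n in l, ∀ i k, ‖emb v (γ n i k)‖ ≤ B' := fun v => by
    by_cases hv₁ : v = v₁
    · subst hv₁
      exact A.exists_norm_emb_le h₁
    by_cases hv₂ : v = v₂
    · subst hv₂
      exact A.exists_norm_emb_le h₂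
    · exact A.exists_norm_emb_le (A.norm_le_one_of_ne hv₁ hv₂)
  choose B' hB' using hb
  have hfin := finite_specialLinearGroup_norm_emb_le (K := K) (∑ v, |B' v|)
  have hmem : ∀ᶠ n in l, γ n ∈ {γ : Matrix.SpecialLinearGroup (Fin 2) (𝓞 K) |
      ∀ (v : InfinitePlace K) i j, ‖emb v (γ i j)‖ ≤ ∑ v, |B' v|} := by
    filter_upwards [eventually_all.2 hB'] with n hn v i k
    exact ((hn v i k).trans (le_abs_self _)).trans
      (Finset.single_le_sum (f := fun v => |B' v|) (fun _ _ => abs_nonneg _) (Finset.mem_univ v))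
  obtain ⟨γ₀, -, hγ₀⟩ := (Ultrafilter.eventually_exists_mem_iff hfin
    (P := fun γ₀ n => γ n = γ₀)).1 (hmem.mono fun n hn => ⟨γ n, hn, rfl⟩)
  have hlim : Tendsto t l (𝓝 (z * (g * diagEmb K γ₀)⁻¹)) := by
    refine (A.tendsto.mul_const _).congr' (hγ₀.mono fun n hn => ?_)
    rw [hn, mul_assoc (t n), mul_inv_cancel_right]
  refine ⟨_, isClosed_diagSubgroup.mem_of_tendsto hlim (Eventually.of_forall A.diag), γ₀, ?_⟩
  rw [mul_assoc, inv_mul_cancel_right]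

/-- The rows of the limit at a place where the `j`-th row is expanded. Here `r` is the integral row
that is contracted at this place, and `a`, `b` are the common directions of the two families of
integral rows. -/
theorem Approach.cross_limit [l.NeBot] (A : Approach l g z v₁ v₂ t γ) (ρ : RationalRows g v)
    {j j' : Fin 2} (hj : j ≠ j') (h : Tendsto (fun n => ‖t n v j j‖) l atTop) {r : Fin 2 → 𝓞 K}
    (hr : cross (ρ.r j) r ≠ 0) {a b : Fin 2 → 𝓞 K}
    (ha : ∀ᶠ n in l, cross (rowMul (ρ.r j) (γ n)) a = 0)
    (hb : ∀ᶠ n in l, cross (rowMul r (γ n)) b = 0) :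
    cross (z v j) (emb v ∘ a) = 0 ∧ cross (z v j') (emb v ∘ b) = 0 := by
  constructor
  · have h1 := ((A.tendsto_row ρ j 0).mul_const (emb v (a 1))).sub
      ((A.tendsto_row ρ j 1).mul_const (emb v (a 0)))
    have h2 := tendsto_nhds_unique (h1.congr' (ha.mono fun n hn => by
      have := congrArg (emb v) hn
      simp only [cross, map_sub, map_mul, map_zero] at this
      change _ = (0 : v.Completion)
      linear_combination (t n v j j) * this)) tendsto_const_nhds
    refine (mul_eq_zero.1 ?_).resolve_left (inv_ne_zero (ρ.c_ne j))
    simp only [cross, Function.comp]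
    linear_combination h2
  · have hD := emb_ne_zero v hr
    have h0 := A.tendsto_zero_of_expanded hj h
    have hz := fun k => (h0.mul (A.tendsto_row_zero ρ h k))
    have hlhs := (((A.tendsto_row ρ j' 0).mul_const (emb v (b 1))).sub
      ((A.tendsto_row ρ j' 1).mul_const (emb v (b 0)))).const_mul (emb v (cross (ρ.r j) r))
    have hrhs := (((hz 0).mul_const (emb v (b 1))).sub
      ((hz 1).mul_const (emb v (b 0)))).const_mul (emb v (cross (ρ.r j') r))
    have h2 := tendsto_nhds_unique (hlhs.congr' (hb.mono fun n hn => by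
      have hn' := congrArg (emb v) hn
      have e0 := congrArg (emb v) (cross_mul_rowMul (ρ.r j) r (ρ.r j') (γ n) 0)
      have e1 := congrArg (emb v) (cross_mul_rowMul (ρ.r j) r (ρ.r j') (γ n) 1)
      rw [map_mul, map_add, map_mul, map_mul] at e0 e1
      rw [cross, map_sub, map_mul, map_mul, map_zero] at hn'
      change _ = emb v (cross (ρ.r j') r) *
        (t n v j' j' * emb v (rowMul (ρ.r j) (γ n) 0) * emb v (b 1) -
          t n v j' j' * emb v (rowMul (ρ.r j) (γ n) 1) * emb v (b 0))
      linear_combination t n v j' j' * emb v (b 1) * e0 - t n v j' j' * emb v (b 0) * e1 +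
        t n v j' j' * emb v (cross (ρ.r j) (ρ.r j')) * hn')) hrhs
    refine (mul_eq_zero.1 ?_).resolve_left (mul_ne_zero (inv_ne_zero (ρ.c_ne j')) hD)
    simp only [cross, Function.comp] at h2 ⊢
    linear_combination h2

end Approach

end

/-! ### The closure of a locally divergent orbit -/

section

variable {K : Type*} [Field K] [NumberField K]

/-- The matrix of determinant `1` with rows `a` and a multiple of `b`. -/
noncomputable def ofRows {F : Type*} [Field F] (a b : Fin 2 → F) (h : cross a b ≠ 0) :
    Matrix.SpecialLinearGroup (Fin 2) F :=
  ⟨!![a 0, a 1; (cross a b)⁻¹ * b 0, (cross a b)⁻¹ * b 1], by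
    rw [Matrix.det_fin_two_of, ← mul_inv_cancel₀ h]
    simp only [cross]
    ring⟩

omit [NumberField K] in
theorem emb_cross (v : InfinitePlace K) (a b : Fin 2 → 𝓞 K) :
    cross (emb v ∘ a) (emb v ∘ b) = emb v (cross a b) := by
  simp only [cross, Function.comp, map_sub, map_mul]

/-- The permutation matrix that carries the first coordinate line to the `j`-th one. -/
def swapTo {R : Type*} [CommRing R] (j : Fin 2) : Matrix.SpecialLinearGroup (Fin 2) R :=
  if j = 0 then 1 else ⟨!![0, -1; 1, 0], by simp [Matrix.det_fin_two]⟩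

theorem swapTo_inv_mul_apply {R : Type*} [CommRing R] (j : Fin 2)
    (y : Matrix.SpecialLinearGroup (Fin 2) R) :
    (∀ k, ((swapTo j)⁻¹ * y : Matrix.SpecialLinearGroup (Fin 2) R) 0 k = y j k) ∧
      ∃ ε : R, ∀ k, ((swapTo j)⁻¹ * y : Matrix.SpecialLinearGroup (Fin 2) R) 1 k
        = ε * y (1 - j) k := by
  obtain rfl | rfl : j = 0 ∨ j = 1 := by fin_cases j <;> simp
  · exact ⟨fun k => by simp [swapTo], 1, fun k => by simp [swapTo]⟩
  · have h : (((swapTo 1)⁻¹ : Matrix.SpecialLinearGroup (Fin 2) R) : Matrix (Fin 2) (Fin 2) R) =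
        !![0, 1; -1, 0] := by
      rw [Matrix.SpecialLinearGroup.coe_inv]
      simp [swapTo, Matrix.adjugate_fin_two]
    refine ⟨fun k => ?_, -1, fun k => ?_⟩ <;>
    rw [Matrix.SpecialLinearGroup.coe_mul, h] <;>
    simp [Matrix.mul_apply, Fin.sum_univ_two]

theorem tendsto_cross_eq_zero {F α : Type*} [NormedField F] {l : Filter α} [l.NeBot]
    {p : α → Fin 2 → F} {y b : Fin 2 → F} (hp : ∀ k, Tendsto (fun n => p n k) l (𝓝 (y k)))
    (h : ∀ᶠ n in l, cross (p n) b = 0) : cross y b = 0 :=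
  tendsto_nhds_unique ((((hp 0).mul_const (b 1)).sub ((hp 1).mul_const (b 0))).congr' h)
    tendsto_const_nhds

section Approach

variable {α : Type*} {l : Filter α} {g z : G K} {v₁ v₂ v : InfinitePlace K} {t : α → G K}
  {γ : α → Matrix.SpecialLinearGroup (Fin 2) (𝓞 K)}

theorem Approach.symm (A : Approach l g z v₁ v₂ t γ) : Approach l g z v₂ v₁ t γ :=
  ⟨A.diag, fun n v h₂ h₁ => A.eq_one n v h₁ h₂, A.tendsto⟩

/-- The integral rows expanded at `v₁` and at `v₂` have eventually constant directions: they are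
nonzero integral vectors, so that the factors that make them converge have bounded norm; for the
two families these factors are inverse to each other. -/
theorem Approach.exists_eventually_cross_eq_zero [l.NeBot] (A : Approach l g z v₁ v₂ t γ)
    (ρ₁ : RationalRows g v₁) (ρ₂ : RationalRows g v₂) (e : InfinitePlace K → Fin 2)
    (h₁ : Tendsto (fun n => ‖t n v₁ (e v₁) (e v₁)‖) l atTop)
    (h₂ : Tendsto (fun n => ‖t n v₂ (1 - e v₂) (1 - e v₂)‖) l atTop) :
    ∃ N, ∀ᶠ n in l, cross (rowMul (ρ₁.r (e v₁)) (γ n)) (rowMul (ρ₁.r (e v₁)) (γ N)) = 0 ∧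
      cross (rowMul (ρ₂.r (1 - e v₂)) (γ n)) (rowMul (ρ₂.r (1 - e v₂)) (γ N)) = 0 := by
  have hne : ∀ j : Fin 2, j ≠ 1 - j := by decide
  have hone : ∀ v, v ≠ v₁ → v ≠ v₂ → ∀ n j, t n v j j = 1 := fun v hv₁ hv₂ n j => by
    rw [A.eq_one n v hv₁ hv₂]
    fin_cases j <;> simp
  have hy₁ : ∀ v k, ∃ y, Tendsto
      (fun n => t n v (e v) (e v) * emb v (rowMul (ρ₁.r (e v₁)) (γ n) k)) l (𝓝 y) := fun v k => by
    by_cases hv₁ : v = v₁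
    · subst hv₁
      exact ⟨_, A.tendsto_row ρ₁ _ k⟩
    by_cases hv₂ : v = v₂
    · subst hv₂
      exact A.exists_tendsto_contracted ρ₂ (hne _).symm h₂ _ k
    · simp only [hone v hv₁ hv₂, one_mul]
      exact ⟨_, A.tendsto_of_ne hv₁ hv₂ _ k⟩
  have hy₂ : ∀ v k, ∃ y, Tendsto
      (fun n => t n v (1 - e v) (1 - e v) * emb v (rowMul (ρ₂.r (1 - e v₂)) (γ n) k)) l
      (𝓝 y) := fun v k => by
    by_cases hv₂ : v = v₂
    · subst hv₂
      exact ⟨_, A.tendsto_row ρ₂ _ k⟩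
    by_cases hv₁ : v = v₁
    · subst hv₁
      exact A.exists_tendsto_contracted ρ₁ (hne _) h₁ _ k
    · simp only [hone v hv₁ hv₂, one_mul]
      exact ⟨_, A.tendsto_of_ne hv₁ hv₂ _ k⟩
  choose y₁ hy₁ using hy₁
  choose y₂ hy₂ using hy₂
  obtain ⟨C₁, hC₁0, hC₁⟩ := exists_prod_norm_le_of_tendsto
    (fun n => rowMul_ne_zero (ρ₁.r_ne (e v₁)) (γ n)) hy₁
  obtain ⟨C₂, hC₂0, hC₂⟩ := exists_prod_norm_le_of_tendsto
    (fun n => rowMul_ne_zero (ρ₂.r_ne (1 - e v₂)) (γ n)) hy₂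
  have hprod : ∀ n, (∏ v : InfinitePlace K, ‖t n v (e v) (e v)‖ ^ v.mult) *
      ∏ v : InfinitePlace K, ‖t n v (1 - e v) (1 - e v)‖ ^ v.mult = 1 := fun n => by
    rw [← Finset.prod_mul_distrib]
    refine Finset.prod_eq_one fun v _ => ?_
    rw [← mul_pow, ← norm_mul, diag_apply_mul_apply (A.diag n) v (hne _), norm_one, one_pow]
  -- the two families of scaling factors are inverse to each other, so that an upper bound for the
  -- norm of one of them is a lower bound for the norm of the other one
  have hlow : ∀ {a b C : ℝ}, 0 < C → 0 ≤ a → a * b = 1 → b ≤ C → C⁻¹ ≤ a :=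
    fun {a b C} hC ha hab hb => by
      rw [inv_le_iff_one_le_mul₀ hC, ← hab]
      exact mul_le_mul_of_nonneg_left hb ha
  have hc₁ := eventually_cross_eq_zero_of_tendsto hy₁ (inv_pos.2 hC₂0)
    (hC₂.mono fun n hn => hlow hC₂0 (Finset.prod_nonneg fun _ _ => by positivity) (hprod n) hn)
  have hc₂ := eventually_cross_eq_zero_of_tendsto hy₂ (inv_pos.2 hC₁0)
    (hC₁.mono fun n hn => hlow hC₁0 (Finset.prod_nonneg fun _ _ => by positivity)
      ((mul_comm _ _).trans (hprod n)) hn)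
  -- fix the second index
  obtain ⟨N, hN⟩ := (hc₁.and hc₂).curry.exists
  exact ⟨N, hN.mono fun n hn => ⟨cross_comm_eq_zero hn.1, cross_comm_eq_zero hn.2⟩⟩

end Approach

/-- The limits of divergent sequences in which `e` prescribes the expanded directions lie on a
single orbit of a conjugate of the diagonal group. -/
theorem exists_eq_of_approach {g : G K} {v₁ v₂ : InfinitePlace K} (hv : v₁ ≠ v₂)
    (ρ₁ : RationalRows g v₁) (ρ₂ : RationalRows g v₂) (e : InfinitePlace K → Fin 2)
    (α : Type*) :
    ∃ M h : G K, ∀ (l : Filter α) (z : G K) (t : α → G K)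
      (γ : α → Matrix.SpecialLinearGroup (Fin 2) (𝓞 K)), l.NeBot → Approach l g z v₁ v₂ t γ →
      Tendsto (fun n => ‖t n v₁ (e v₁) (e v₁)‖) l atTop →
      Tendsto (fun n => ‖t n v₂ (1 - e v₂) (1 - e v₂)‖) l atTop →
      ∃ a ∈ diagSubgroup K, ∃ γ₀, z = M * a * h * diagEmb K γ₀ := by
  have hne : ∀ j : Fin 2, j ≠ 1 - j := by decide
  by_cases h0 : cross (ρ₁.r (e v₁)) (ρ₂.r (1 - e v₂)) = 0
  · exact ⟨1, 1, fun l z t γ _ A h₁ h₂ => absurd h0 (A.cross_ne_zero hv ρ₁ ρ₂ h₁ h₂)⟩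
  set r₁ := ρ₁.r (e v₁) with hr₁
  set r₂ := ρ₂.r (1 - e v₂) with hr₂
  have hD : ∀ v, cross (emb v ∘ r₁) (emb v ∘ r₂) ≠ 0 := fun v => by
    rw [emb_cross]
    exact emb_ne_zero v h0
  let h : G K := fun v => ofRows (emb v ∘ r₁) (emb v ∘ r₂) (hD v)
  classical
  -- at `v₁` and `v₂` the limit has rows proportional to `r₁ γ_N` and `r₂ γ_N`, in an order given by
  -- `e`; at the other places this is the case for `h g⁻¹ z`
  let M : G K := fun v => if v = v₁ ∨ v = v₂ then swapTo (e v) else g v * (h v)⁻¹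
  refine ⟨M, h, fun l z t γ _ A h₁ h₂ => ?_⟩
  obtain ⟨N, hN⟩ := A.exists_eventually_cross_eq_zero ρ₁ ρ₂ e h₁ h₂
  have hN₁ := hN.mono fun n hn => hn.1
  have hN₂ := hN.mono fun n hn => hn.2
  have hk0 : ∀ v k, (h * diagEmb K (γ N)) v 0 k = emb v (rowMul r₁ (γ N) k) := fun v k => by
    rw [mul_diagEmb_apply]
    simp only [rowMul, map_add, map_mul]
    rfl
  have hk1 : ∀ v k, (h * diagEmb K (γ N)) v 1 k =
      (cross (emb v ∘ r₁) (emb v ∘ r₂))⁻¹ * emb v (rowMul r₂ (γ N) k) := fun v k => by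
    rw [mul_diagEmb_apply]
    simp only [rowMul, map_add, map_mul]
    change _ * emb v (r₂ 0) * _ + _ * emb v (r₂ 1) * _ = _
    ring
  have hrow : ∀ v, cross ((M⁻¹ * z) v 0) (emb v ∘ rowMul r₁ (γ N)) = 0 ∧
      cross ((M⁻¹ * z) v 1) (emb v ∘ rowMul r₂ (γ N)) = 0 := fun v => by
    by_cases hv12 : v = v₁ ∨ v = v₂
    · have hM : (M⁻¹ * z) v = (swapTo (e v))⁻¹ * z v := by
        simp only [Pi.mul_apply, Pi.inv_apply, M, if_pos hv12]
      rw [hM]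
      obtain ⟨hs0, ε, hs1⟩ := swapTo_inv_mul_apply (e v) (z v)
      have hz : cross (z v (e v)) (emb v ∘ rowMul r₁ (γ N)) = 0 ∧
          cross (z v (1 - e v)) (emb v ∘ rowMul r₂ (γ N)) = 0 := by
        rcases hv12 with rfl | rfl
        · exact A.cross_limit ρ₁ (hne _) h₁ h0 hN₁ hN₂
        · exact (A.cross_limit ρ₂ (hne _).symm h₂ (fun h => h0 (cross_comm_eq_zero h)) hN₂
            hN₁).symm
      simp only [cross] at hz ⊢
      rw [hs0, hs0, hs1, hs1]
      exact ⟨hz.1, by linear_combination ε * hz.2⟩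
    · have hM : ∀ i k, (M⁻¹ * z) v i k =
          h v i 0 * (g⁻¹ * z) v 0 k + h v i 1 * (g⁻¹ * z) v 1 k := fun i k => by
        have : (M⁻¹ * z) v = (h * (g⁻¹ * z)) v := by
          simp only [Pi.mul_apply, Pi.inv_apply, M, if_neg hv12, mul_inv_rev, inv_inv, mul_assoc]
        rw [this, G_mul_apply]
      push Not at hv12
      constructor
      · refine tendsto_cross_eq_zero (l := l) (p := fun n => emb v ∘ rowMul r₁ (γ n))
          (fun k => ?_) (hN₁.mono fun n hn => by rw [emb_cross, hn, map_zero])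
        rw [hM]
        exact A.tendsto_of_ne hv12.1 hv12.2 r₁ k
      · have h1 := tendsto_cross_eq_zero (l := l) (p := fun n => emb v ∘ rowMul r₂ (γ n))
          (fun k => A.tendsto_of_ne hv12.1 hv12.2 r₂ k)
          (hN₂.mono fun n hn => by rw [emb_cross, hn, map_zero])
        simp only [cross] at h1 ⊢
        rw [hM, hM]
        change (_ * emb v (r₂ 0) * _ + _ * emb v (r₂ 1) * _) * _ -
          (_ * emb v (r₂ 0) * _ + _ * emb v (r₂ 1) * _) * _ = _
        linear_combination (cross (emb v ∘ r₁) (emb v ∘ r₂))⁻¹ * h1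
  refine ⟨M⁻¹ * z * (h * diagEmb K (γ N))⁻¹, mul_inv_mem_diagSubgroup fun v i => ?_, γ N, ?_⟩
  · have hv' := hrow v
    simp only [cross, Function.comp] at hv'
    fin_cases i
    · change (M⁻¹ * z) v 0 0 * (h * diagEmb K (γ N)) v 0 1 -
        (M⁻¹ * z) v 0 1 * (h * diagEmb K (γ N)) v 0 0 = 0
      rw [hk0, hk0]
      exact hv'.1
    · change (M⁻¹ * z) v 1 0 * (h * diagEmb K (γ N)) v 1 1 -
        (M⁻¹ * z) v 1 1 * (h * diagEmb K (γ N)) v 1 0 = 0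
      rw [hk1, hk1]
      linear_combination (cross (emb v ∘ r₁) (emb v ∘ r₂))⁻¹ * hv'.2
  · simp [mul_assoc]

theorem eventually_norm_le_or_tendsto_atTop {F α : Type*} [NormedField F] (l : Ultrafilter α)
    (x : α → Matrix.SpecialLinearGroup (Fin 2) F) :
    (∃ B : ℝ, ∀ᶠ n in l, ∀ i, ‖x n i i‖ ≤ B) ∨
      ∃ j, Tendsto (fun n => ‖x n j j‖) l atTop := by
  by_cases h : ∃ j, Tendsto (fun n => ‖x n j j‖) l atTop
  · exact Or.inr h
  · push Not at h
    have h1 : ∀ j, ∃ B : ℝ, ∀ᶠ n in l, ‖x n j j‖ ≤ B := fun j => by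
      have h2 := h j
      rw [tendsto_atTop] at h2
      push Not at h2
      obtain ⟨B, hB⟩ := h2
      exact ⟨B, hB.mono fun n hn => hn.le⟩
    choose B hB using h1
    exact Or.inl ⟨max (B 0) (B 1), eventually_all.2 fun i => (hB i).mono fun n hn =>
      hn.trans (by fin_cases i; exacts [le_max_left _ _, le_max_right _ _])⟩

theorem exists_eq_of_π_eq {g h : G K} (hgh : π g = π h) : ∃ γ, h = g * diagEmb K γ := by
  obtain ⟨γ, hγ⟩ : g⁻¹ * h ∈ Γ K := QuotientGroup.eq.1 hgh
  exact ⟨γ, by rw [hγ, mul_inv_cancel_left]⟩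

/-- The limits of an orbit in `G/Γ` lift to limits in `G`. -/
theorem exists_ultrafilter_of_mem_closure_orbit {T : Subgroup (G K)} {g z : G K}
    (hz : π z ∈ closure (MulAction.orbit T (π g))) :
    ∃ l : Ultrafilter (T × Matrix.SpecialLinearGroup (Fin 2) (𝓞 K)),
      Tendsto (fun p : T × Matrix.SpecialLinearGroup (Fin 2) (𝓞 K) =>
        (p.1 : G K) * g * diagEmb K p.2) l (𝓝 z) := by
  have hz' : z ∈ closure ((π : G K → Space K) ⁻¹' MulAction.orbit T (π g)) := by
    have : IsOpenMap (π : G K → Space K) := QuotientGroup.isOpenMap_coe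
    rw [← this.preimage_closure_eq_closure_preimage QuotientGroup.continuous_mk]
    exact hz
  have : (comap (fun p : T × Matrix.SpecialLinearGroup (Fin 2) (𝓞 K) =>
      (p.1 : G K) * g * diagEmb K p.2) (𝓝 z)).NeBot := by
    rw [comap_neBot_iff]
    intro U hU
    obtain ⟨x, hx, s, hs⟩ := mem_closure_iff_nhds.1 hz' U hU
    obtain ⟨γ, rfl⟩ := exists_eq_of_π_eq (g := (s : G K) * g) (h := x) hs
    exact ⟨(s, γ), hx⟩
  exact ⟨Ultrafilter.of _, tendsto_iff_comap.2 (Ultrafilter.of_le _)⟩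

/-- The closure of a locally divergent orbit is contained in finitely many orbits of conjugates of
the diagonal group. -/
theorem exists_closure_orbit_subset {g : G K} {v₁ v₂ : InfinitePlace K} (hv : v₁ ≠ v₂)
    (ρ₁ : RationalRows g v₁) (ρ₂ : RationalRows g v₂) {T : Subgroup (G K)}
    (hT : ∀ t ∈ T, t ∈ diagSubgroup K ∧ ∀ v, v ≠ v₁ → v ≠ v₂ → t v = 1) :
    ∃ M h : Option (InfinitePlace K → Fin 2) → G K, ∀ z : G K,
      π z ∈ closure (MulAction.orbit T (π g)) →
      ∃ i, ∃ a ∈ diagSubgroup K, ∃ γ₀, z = M i * a * h i * diagEmb K γ₀ := by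
  choose M h hM using fun e => exists_eq_of_approach hv ρ₁ ρ₂ e
    (T × Matrix.SpecialLinearGroup (Fin 2) (𝓞 K))
  refine ⟨fun i => i.elim 1 M, fun i => i.elim g h, fun z hz => ?_⟩
  obtain ⟨l, hl⟩ := exists_ultrafilter_of_mem_closure_orbit hz
  obtain ⟨t, ht⟩ : ∃ t : T × Matrix.SpecialLinearGroup (Fin 2) (𝓞 K) → G K,
      t = fun p => (p.1 : G K) := ⟨_, rfl⟩
  obtain ⟨γ, hγ⟩ : ∃ γ : T × Matrix.SpecialLinearGroup (Fin 2) (𝓞 K) →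
      Matrix.SpecialLinearGroup (Fin 2) (𝓞 K), γ = fun p => p.2 := ⟨_, rfl⟩
  have A : Approach (l : Filter _) g z v₁ v₂ t γ := by
    subst ht hγ
    exact ⟨fun p => (hT _ p.1.2).1, fun p => (hT _ p.1.2).2, hl⟩
  rcases eventually_norm_le_or_tendsto_atTop l (fun p => t p v₁) with ⟨B₁, h₁⟩ | ⟨j₁, h₁⟩
  · rcases eventually_norm_le_or_tendsto_atTop l (fun p => t p v₂) with ⟨B₂, h₂⟩ | ⟨j₂, h₂⟩
    · obtain ⟨a, ha, γ₀, hz⟩ := A.exists_eq_of_bounded (B := max B₁ B₂)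
        (h₁.mono fun n hn i => (hn i).trans (le_max_left _ _))
        (h₂.mono fun n hn i => (hn i).trans (le_max_right _ _))
      refine ⟨none, a, ha, γ₀, ?_⟩
      rw [hz]
      simp only [Option.elim_none, one_mul]
    · exact (A.symm.false_of_bounded ρ₂ h₂ h₁).elim
  · rcases eventually_norm_le_or_tendsto_atTop l (fun p => t p v₂) with ⟨B₂, h₂⟩ | ⟨j₂, h₂⟩
    · exact (A.false_of_bounded ρ₁ h₁ h₂).elim
    · classical
      obtain ⟨e, he₁, he₂⟩ : ∃ e : InfinitePlace K → Fin 2, e v₁ = j₁ ∧ 1 - e v₂ = j₂ :=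
        ⟨fun v => if v = v₁ then j₁ else 1 - j₂, if_pos rfl, by
          simp only [if_neg hv.symm, sub_sub_cancel]⟩
      subst he₁ he₂
      obtain ⟨a, ha, γ₀, hz⟩ := hM e l z t γ inferInstance A h₁ h₂
      exact ⟨some e, a, ha, γ₀, hz⟩

end

/-! ### Closed subgroups near the identity -/

section

/-- The largest linear subspace that is contained in an additive subgroup. -/
def lieSubspace {E : Type*} [AddCommGroup E] [Module ℝ E] (A : AddSubgroup E) : Submodule ℝ E where
  carrier := {x | ∀ c : ℝ, c • x ∈ A}
  add_mem' hx hy c := by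
    rw [smul_add]
    exact add_mem (hx c) (hy c)
  zero_mem' c := by
    rw [smul_zero]
    exact zero_mem _
  smul_mem' b x hx c := by
    rw [smul_smul]
    exact hx _

theorem mem_of_mem_lieSubspace {E : Type*} [AddCommGroup E] [Module ℝ E] {A : AddSubgroup E} {x : E}
    (hx : x ∈ lieSubspace A) : x ∈ A := by
  simpa using hx 1

/-- A limit of directions of elements of `A` that tend to zero spans a line in `A`. -/
theorem mem_lieSubspace_of_tendsto {E : Type*} [NormedAddCommGroup E] [NormedSpace ℝ E]
    {A : AddSubgroup E} (hA : IsClosed (A : Set E)) {l : Filter E} [l.NeBot] (hl : l ≤ 𝓝 0)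
    (hlA : ∀ᶠ s in l, s ∈ A ∧ s ≠ 0) {w : E} (hw : Tendsto (fun s : E => ‖s‖⁻¹ • s) l (𝓝 w)) :
    w ∈ lieSubspace A := by
  intro c
  have h1 : Tendsto (fun s : E => (c * ‖s‖⁻¹) • s) l (𝓝 (c • w)) :=
    (hw.const_smul c).congr fun s => smul_smul _ _ _
  have h2 : Tendsto (fun s : E => Int.fract (c * ‖s‖⁻¹) • s) l (𝓝 0) := by
    refine squeeze_zero_norm (fun s => ?_) ((tendsto_norm_zero (E := E)).mono_left hl)
    rw [norm_smul, Real.norm_eq_abs, abs_of_nonneg (Int.fract_nonneg _)]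
    exact mul_le_of_le_one_left (norm_nonneg _) (Int.fract_lt_one _).le
  have h3 : Tendsto (fun s : E => ⌊c * ‖s‖⁻¹⌋ • s) l (𝓝 (c • w)) := by
    refine ((h1.sub h2).congr fun s => ?_).trans (by rw [sub_zero])
    rw [← sub_smul, Int.self_sub_fract, Int.cast_smul_eq_zsmul]
  exact hA.mem_of_tendsto h3 (hlA.mono fun s hs => zsmul_mem hs.1 _)

/-- A closed subgroup of a finite-dimensional space agrees with a linear subspace near zero. -/
theorem eventually_mem_lieSubspace {E : Type*} [NormedAddCommGroup E] [NormedSpace ℝ E]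
    [FiniteDimensional ℝ E] {A : AddSubgroup E} (hA : IsClosed (A : Set E)) :
    ∀ᶠ s in 𝓝 (0 : E), s ∈ A → s ∈ lieSubspace A := by
  obtain ⟨W, hW⟩ := (lieSubspace A).exists_isCompl
  -- subtracting the component in the linear subspace moves a bad element of `A` into `A ∩ W`
  let P : E →ₗ[ℝ] E := W.projection (lieSubspace A) hW.symm
  have hPW : ∀ s, P s ∈ W := fun s => Submodule.projection_apply_mem hW.symm s
  have hPV : ∀ s, s - P s ∈ lieSubspace A := fun s => by
    rw [← Submodule.projection_apply_eq_zero_iff hW.symm, map_sub, sub_eq_zero]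
    exact (Submodule.projection_apply_of_mem_left hW.symm (hPW s)).symm
  by_contra hcon
  have hfr : ∃ᶠ s in 𝓝 (0 : E), s ∈ A ∧ s ∉ lieSubspace A := by
    simpa only [Filter.not_eventually, Classical.not_imp] using hcon
  have hP : Tendsto P (𝓝 0) (𝓝 0) := by
    simpa using (P.continuous_of_finiteDimensional.tendsto 0)
  have hfr' : ∃ᶠ s in 𝓝 (0 : E), s ∈ A ∧ s ∈ W ∧ s ≠ 0 := by
    refine hP.frequently (hfr.mono fun s hs => ⟨?_, hPW s, fun h0 => hs.2 ?_⟩)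
    · simpa using sub_mem hs.1 (mem_of_mem_lieSubspace (hPV s))
    · simpa [h0] using hPV s
  have hne : (𝓝 (0 : E) ⊓ 𝓟 {s | s ∈ A ∧ s ∈ W ∧ s ≠ 0}).NeBot := frequently_mem_iff_neBot.1 hfr'
  obtain ⟨l, hl⟩ := Ultrafilter.exists_le (𝓝 (0 : E) ⊓ 𝓟 {s | s ∈ A ∧ s ∈ W ∧ s ≠ 0})
  have hlA : ∀ᶠ s in (l : Filter E), s ∈ A ∧ s ∈ W ∧ s ≠ 0 :=
    (hl.trans inf_le_right) (mem_principal_self _)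
  obtain ⟨w, hw, hlw⟩ := (isCompact_sphere (0 : E) 1).ultrafilter_le_nhds
    (l.map fun s : E => ‖s‖⁻¹ • s) (by
      rw [le_principal_iff]
      exact hlA.mono fun s hs => by simp [norm_smul, hs.2.2])
  have h1 := mem_lieSubspace_of_tendsto hA (hl.trans inf_le_left)
    (hlA.mono fun s hs => ⟨hs.1, hs.2.2⟩) (w := w) hlw
  have h2 : w ∈ W := W.closed_of_finiteDimensional.mem_of_tendsto (f := fun s : E => ‖s‖⁻¹ • s)
    hlw (hlA.mono fun s hs => W.smul_mem _ hs.2.1)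
  have h0 := Submodule.disjoint_def.1 hW.disjoint w h1 h2
  simp [h0] at hw

section TopologicalGroup

variable {H : Type*} [Group H] [TopologicalSpace H] [IsTopologicalGroup H] [LocallyCompactSpace H]

/-- If countably many sets `mᵢ A hᵢ` cover `F g`, where `F` and `A` are closed subgroups, then `F`
is contained in one of the conjugates `mᵢ A mᵢ⁻¹` near the identity. -/
theorem exists_eventually_conj_mem {F A : Subgroup H} (hF : IsClosed (F : Set H))
    (hA : IsClosed (A : Set H)) {ι : Type*} [Countable ι] {m h : ι → H} {g : H}
    (hcov : ∀ f ∈ F, ∃ i, ∃ a ∈ A, f * g = m i * a * h i) :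
    ∃ i, ∀ᶠ f : F in 𝓝 1, (m i)⁻¹ * f * m i ∈ A := by
  have : LocallyCompactSpace F := hF.locallyCompactSpace
  -- by Baire's theorem one of the closed sets `C i` has an interior point `f₀`; the quotients
  -- `(f f₀) f₀⁻¹` with `f f₀ ∈ C i` then lie in the conjugate of `A`
  let C : ι → Set F := fun i => {f | (m i)⁻¹ * (f * g) * (h i)⁻¹ ∈ A}
  have hC : ∀ i, IsClosed (C i) := fun i => hA.preimage
    (f := fun f : F => (m i)⁻¹ * (f * g) * (h i)⁻¹) (by fun_prop)
  have hU : ⋃ i, C i = Set.univ := by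
    refine Set.eq_univ_of_forall fun f => ?_
    obtain ⟨i, a, ha, hfa⟩ := hcov f f.2
    refine Set.mem_iUnion.2 ⟨i, ?_⟩
    change (m i)⁻¹ * (f * g) * (h i)⁻¹ ∈ A
    rw [hfa]
    simpa [mul_assoc] using ha
  obtain ⟨i, f₀, hf₀⟩ := nonempty_interior_of_iUnion_of_closed hC hU
  refine ⟨i, ?_⟩
  have h1 : Tendsto (fun f : F => f * f₀) (𝓝 1) (𝓝 f₀) := by
    simpa using (continuous_mul_const f₀).tendsto (1 : F)
  filter_upwards [h1 (mem_interior_iff_mem_nhds.1 hf₀)] with f hf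
  have h2 := mul_mem (show (m i)⁻¹ * ((f * f₀ : F) * g) * (h i)⁻¹ ∈ A from hf)
    (inv_mem (show (m i)⁻¹ * (f₀ * g) * (h i)⁻¹ ∈ A from
      (interior_subset hf₀ : f₀ ∈ C i)))
  rw [Subgroup.coe_mul] at h2
  have h3 : (m i)⁻¹ * f * m i = (m i)⁻¹ * (f * f₀ * g) * (h i)⁻¹ *
      ((m i)⁻¹ * (f₀ * g) * (h i)⁻¹)⁻¹ := by
    group
  rw [h3]
  exact h2

/-- If the orbit of a closed subgroup is closed, then so are the orbits of its open subgroups. -/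
theorem isClosed_orbit_of_isOpen_subgroupOf [SecondCountableTopology H] {X : Type*}
    [TopologicalSpace X] [LocallyCompactSpace X] [T2Space X] [MulAction H X] [ContinuousSMul H X]
    {F U : Subgroup H} (hF : IsClosed (F : Set H)) (hU : IsOpen (U.subgroupOf F : Set F))
    (hUF : U ≤ F) {x : X} (hx : IsClosed (MulAction.orbit F x)) :
    IsClosed (MulAction.orbit U x) := by
  have : LocallyCompactSpace F := hF.locallyCompactSpace
  have : LocallyCompactSpace (MulAction.orbit F x) := hx.locallyCompactSpace
  have : ContinuousSMul F (MulAction.orbit F x) :=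
    ⟨Continuous.subtype_mk (by
      exact (continuous_subtype_val.comp continuous_fst).smul
        (continuous_subtype_val.comp continuous_snd)) _⟩
  let x₀ : MulAction.orbit F x := ⟨x, MulAction.mem_orbit_self x⟩
  have : SecondCountableTopology F := TopologicalSpace.Subtype.secondCountableTopology _
  have : SigmaCompactSpace F := sigmaCompactSpace_of_locallyCompact_secondCountable
  have hop := isOpenMap_smul_of_sigmaCompact (G := F) x₀
  let O : Set F := {f | (f : H) • x ∉ MulAction.orbit U x}
  -- `O` is a union of cosets `U f`
  have hO : IsOpen O := by
    rw [isOpen_iff_mem_nhds]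
    intro f hf
    have h1 : Tendsto (fun f' : F => f' * f⁻¹) (𝓝 f) (𝓝 1) := by
      simpa using (continuous_mul_const f⁻¹).tendsto f
    filter_upwards [h1 (hU.mem_nhds (one_mem _))] with f' hf' hmem
    obtain ⟨u, hu⟩ := hmem
    refine hf ⟨⟨_, inv_mem (Subgroup.mem_subgroupOf.1 hf')⟩ * u, ?_⟩
    have hu' : (u : H) • x = (f' : H) • x := hu
    change (((f' * f⁻¹ : F) : H)⁻¹ * (u : H)) • x = (f : H) • x
    rw [mul_smul, hu', smul_smul]
    congr 1
    rw [Subgroup.coe_mul, Subgroup.coe_inv]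
    group
  have hcl : IsClosed (Subtype.val ⁻¹' MulAction.orbit U x : Set (MulAction.orbit F x)) := by
    rw [← isOpen_compl_iff]
    convert hop O hO using 1
    ext ⟨y, f, hf⟩
    constructor
    · intro hy
      exact ⟨f, fun h => hy (by change y ∈ MulAction.orbit U x; rw [← hf]; exact h), Subtype.ext hf⟩
    · rintro ⟨f', hf', h⟩ hy
      exact hf' (by rw [← h] at hy; exact hy)
  have := hx.isClosedEmbedding_subtypeVal.isClosedMap _ hcl
  rwa [Subtype.image_preimage_coe, Set.inter_eq_right.2] at this
  rintro _ ⟨u, rfl⟩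
  exact ⟨⟨u, hUF u.2⟩, rfl⟩

end TopologicalGroup

variable {K : Type*} [Field K] [NumberField K]

/-- A diagonal element near the identity lies in the identity component. -/
theorem eventually_mem_D_of_mem_diagSubgroup :
    ∀ᶠ h in 𝓝 (1 : G K), h ∈ diagSubgroup K → h ∈ D Finset.univ := by
  have h1 : ∀ᶠ h in 𝓝 (1 : G K), ∀ (v : InfinitePlace K) (hv : v.IsReal),
      0 < InfinitePlace.Completion.extensionEmbeddingOfIsReal hv (h v 0 0) := by
    refine eventually_all.2 fun v => ?_
    by_cases hv : v.IsReal
    · have hc : Continuous (InfinitePlace.Completion.extensionEmbeddingOfIsReal hv) :=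
        (InfinitePlace.Completion.isometry_extensionEmbeddingOfIsReal hv).continuous
      have := ((hc.comp (continuous_entry v 0 0)).tendsto (1 : G K)).eventually_const_lt (u := 0)
        (by simp)
      exact this.mono fun h hh _ => hh
    · exact Eventually.of_forall fun h hv' => absurd hv' hv
  filter_upwards [h1] with h hh hd v
  refine ⟨fun _ => ⟨Units.mk (h v 0 0) (h v 1 1) (diag_apply_mul_apply hd v (by decide))
    (diag_apply_mul_apply hd v (by decide)), fun hv => hh v hv, ?_⟩, fun hv =>
      absurd (Finset.mem_univ v) hv⟩
  apply Subtype.ext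
  ext i j
  fin_cases i <;> fin_cases j
  · rfl
  · exact congrArg _ (hd v).1.symm
  · exact congrArg _ (hd v).2.symm
  · rfl

end

/-! ### Homogeneous orbit closures -/

section

variable {K : Type*} [Field K] [NumberField K]

/-- The elements `f` such that `f` and `f⁻¹` preserve the set `S`. -/
def setStabilizer {H X : Type*} [Group H] [MulAction H X] (S : Set X) : Subgroup H where
  carrier := {f | ∀ z ∈ S, f • z ∈ S ∧ f⁻¹ • z ∈ S}
  mul_mem' ha hb z hz := by
    rw [mul_inv_rev, mul_smul, mul_smul]
    exact ⟨(ha _ (hb z hz).1).1, (hb _ (ha z hz).2).2⟩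
  one_mem' z hz := by simpa using hz
  inv_mem' ha z hz := by
    rw [inv_inv]
    exact (ha z hz).symm

theorem isClosed_setStabilizer {H X : Type*} [Group H] [TopologicalSpace H] [IsTopologicalGroup H]
    [TopologicalSpace X] [MulAction H X] [ContinuousSMul H X] {S : Set X} (hS : IsClosed S) :
    IsClosed ((setStabilizer S : Subgroup H) : Set H) := by
  have : ((setStabilizer S : Subgroup H) : Set H) =
      ⋂ z ∈ S, {f : H | f • z ∈ S} ∩ {f | f⁻¹ • z ∈ S} := by
    ext f
    simp [setStabilizer]
  rw [this]
  exact isClosed_biInter fun z _ => (hS.preimage (continuous_id.smul continuous_const)).inter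
    (hS.preimage (continuous_inv.smul continuous_const))

/-- A subgroup preserves its orbits. -/
theorem le_setStabilizer_orbit {H X : Type*} [Group H] [MulAction H X] (F : Subgroup H) (x : X) :
    F ≤ setStabilizer (MulAction.orbit F x) := by
  rintro f hf _ ⟨a, rfl⟩
  refine ⟨⟨⟨f, hf⟩ * a, mul_smul _ _ _⟩, ⟨(⟨f, hf⟩ : F)⁻¹ * a, mul_smul _ _ _⟩⟩

theorem setStabilizer_le_closure {H X : Type*} [Group H] [TopologicalSpace X] [MulAction H X]
    [ContinuousConstSMul H X] (S : Set X) :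
    (setStabilizer S : Subgroup H) ≤ setStabilizer (closure S) := by
  intro f hf z hz
  exact ⟨map_mem_closure (continuous_const_smul f) hz fun y hy => (hf y hy).1,
    map_mem_closure (continuous_const_smul f⁻¹) hz fun y hy => (hf y hy).2⟩

/-- The conjugate by `m` of the exponential of a linear subspace. -/
noncomputable def conjExp (m : G K) (V : Submodule ℝ (InfinitePlace K → ℂ)) : Subgroup (G K) where
  carrier := {f | ∃ s ∈ V, m * diagExp s * m⁻¹ = f}
  mul_mem' := by
    rintro _ _ ⟨s, hs, rfl⟩ ⟨t, ht, rfl⟩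
    refine ⟨s + t, add_mem hs ht, ?_⟩
    rw [diagExp_add]
    group
  one_mem' := ⟨0, zero_mem _, by rw [diagExp_zero]; group⟩
  inv_mem' := by
    rintro _ ⟨s, hs, rfl⟩
    refine ⟨-s, neg_mem hs, ?_⟩
    rw [diagExp_neg]
    group

theorem isConnected_conjExp (m : G K) (V : Submodule ℝ (InfinitePlace K → ℂ)) :
    IsConnected (conjExp m V : Set (G K)) := by
  have : (conjExp m V : Set (G K)) = (fun s => m * diagExp s * m⁻¹) '' V := rfl
  rw [this]
  have hV : IsConnected (V : Set (InfinitePlace K → ℂ)) :=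
    V.convex.isConnected ⟨0, zero_mem _⟩
  exact hV.image _ ((continuous_const.mul continuous_diagExp).mul continuous_const).continuousOn

theorem isTorus_conjExp {m : G K} {V : Submodule ℝ (InfinitePlace K → ℂ)}
    (h : IsClosed (conjExp m V : Set (G K))) : IsTorus (conjExp m V) := by
  refine ⟨conjExp 1 V, m, ?_, ?_, isConnected_conjExp 1 V, ?_⟩
  · rintro _ ⟨s, -, rfl⟩
    exact mem_D_univ_iff.2 ⟨s, by group⟩
  · have : (conjExp 1 V : Set (G K)) = (fun f => m * f * m⁻¹) ⁻¹' conjExp m V := by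
      ext f
      constructor
      · rintro ⟨s, hs, rfl⟩
        exact ⟨s, hs, by group⟩
      · rintro ⟨s, hs, h⟩
        exact ⟨s, hs, by simpa using h⟩
    rw [this]
    exact h.preimage (f := fun f : G K => m * f * m⁻¹)
      ((continuous_const.mul continuous_id).mul continuous_const)
  · ext f
    constructor
    · rintro ⟨s, hs, rfl⟩
      exact ⟨diagExp s, ⟨s, hs, by group⟩, rfl⟩
    · rintro ⟨_, ⟨s, hs, rfl⟩, rfl⟩
      exact ⟨s, hs, by simp⟩

/-- A closed subgroup that near the identity lies in a conjugate of the diagonal group has an open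
subgroup that is a torus. -/
theorem exists_conjExp_le {F : Subgroup (G K)} (hF : IsClosed (F : Set (G K))) {m : G K}
    (hm : ∀ᶠ f : F in 𝓝 1, m⁻¹ * f * m ∈ diagSubgroup K) :
    ∃ V, conjExp m V ≤ F ∧ IsOpen ((conjExp m V).subgroupOf F : Set F) := by
  let A : AddSubgroup (InfinitePlace K → ℂ) :=
    { carrier := {s | m * diagExp s * m⁻¹ ∈ F}
      add_mem' := fun {s t} hs ht => by
        have := mul_mem (S := Subgroup (G K)) (s := F) hs ht
        change m * diagExp (s + t) * m⁻¹ ∈ F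
        convert this using 1
        rw [diagExp_add]
        group
      zero_mem' := by
        change m * diagExp 0 * m⁻¹ ∈ F
        rw [diagExp_zero, mul_one, mul_inv_cancel]
        exact one_mem _
      neg_mem' := fun {s} hs => by
        have : (m * diagExp s * m⁻¹)⁻¹ ∈ F := inv_mem hs
        change m * diagExp (-s) * m⁻¹ ∈ F
        convert this using 1
        rw [diagExp_neg]
        group }
  have hA : IsClosed (A : Set (InfinitePlace K → ℂ)) :=
    hF.preimage (f := fun s => m * diagExp s * m⁻¹)
      ((continuous_const.mul continuous_diagExp).mul continuous_const)
  refine ⟨lieSubspace A, ?_, ?_⟩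
  · rintro _ ⟨s, hs, rfl⟩
    exact mem_of_mem_lieSubspace hs
  · have h1 : Tendsto (fun f : F => m⁻¹ * (f : G K) * m) (𝓝 1) (𝓝 1) := by
      have hc : Continuous fun f : F => m⁻¹ * (f : G K) * m :=
        (continuous_const.mul continuous_subtype_val).mul continuous_const
      simpa using hc.tendsto 1
    refine Subgroup.isOpen_of_mem_nhds _ (g := 1) ?_
    filter_upwards [hm, h1.eventually eventually_mem_D_of_mem_diagSubgroup,
      (tendsto_diagLog.comp h1).eventually (eventually_mem_lieSubspace hA)] with f hf hD hV
    have h2 := diagExp_diagLog (hD hf)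
    have h3 : m * diagExp (diagLog (m⁻¹ * (f : G K) * m)) * m⁻¹ = f := by
      rw [h2]
      group
    exact Subgroup.mem_subgroupOf.2 ⟨_, hV (by
      change m * diagExp (diagLog (m⁻¹ * (f : G K) * m)) * m⁻¹ ∈ F
      rw [h3]
      exact f.2), h3⟩

/-- An orbit closure that is contained in countably many orbits of conjugates of the diagonal group
and is an orbit of a closed group is an orbit of a torus. -/
theorem isTorusOrbit_closure_of_eq_orbit {T F : Subgroup (G K)} {g : G K} {y : Space K}
    (hT : IsPreconnected (T : Set (G K))) {ι : Type*} [Countable ι] {M h : ι → G K}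
    (hcov : ∀ z : G K, π z ∈ closure (MulAction.orbit T (π g)) →
      ∃ i, ∃ a ∈ diagSubgroup K, ∃ γ, z = M i * a * h i * diagEmb K γ)
    (hF : closure (MulAction.orbit T (π g)) = MulAction.orbit F y) :
    IsTorusOrbit (closure (MulAction.orbit T (π g))) := by
  set S := closure (MulAction.orbit T (π g)) with hS
  have hScl : IsClosed S := isClosed_closure
  have hgS : π g ∈ S := subset_closure (MulAction.mem_orbit_self _)
  -- the stabilizer of the closure contains both `T` and `F`
  obtain ⟨F', hF', hTF, hFF, hF'S⟩ : ∃ F' : Subgroup (G K), IsClosed (F' : Set (G K)) ∧ T ≤ F' ∧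
      F ≤ F' ∧ ∀ f ∈ F', ∀ z ∈ S, f • z ∈ S := by
    refine ⟨setStabilizer S, isClosed_setStabilizer hScl,
      (le_setStabilizer_orbit T (π g)).trans (setStabilizer_le_closure _), ?_,
      fun f hf z hz => (hf z hz).1⟩
    rw [hF]
    exact le_setStabilizer_orbit F y
  have hSF : S = MulAction.orbit F' (π g) := by
    refine Set.Subset.antisymm (fun z hz => ?_) ?_
    · rw [hF] at hz hgS
      obtain ⟨a, rfl⟩ := hz
      obtain ⟨b, hb⟩ := hgS
      refine ⟨⟨a, hFF a.2⟩ * ⟨b, hFF b.2⟩⁻¹, ?_⟩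
      rw [← hb]
      change ((a : G K) * (b : G K)⁻¹) • ((b : G K) • y) = (a : G K) • y
      rw [smul_smul, inv_mul_cancel_right]
    · rintro _ ⟨f, rfl⟩
      exact hF'S f f.2 _ hgS
  obtain ⟨⟨i, γ⟩, hi⟩ := exists_eventually_conj_mem hF' isClosed_diagSubgroup
    (m := fun p : ι × Matrix.SpecialLinearGroup (Fin 2) (𝓞 K) => M p.1)
    (h := fun p => h p.1 * diagEmb K p.2) (g := g) fun f hf => by
      obtain ⟨i, a, ha, γ, h⟩ := hcov (f * g) (hF'S f hf _ hgS)
      exact ⟨(i, γ), a, ha, by rw [h, mul_assoc (M i * a)]⟩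
  obtain ⟨V, hVF, hV⟩ := exists_conjExp_le hF' hi
  have hVcl' := Subgroup.isClosed_of_isOpen _ hV
  have hVcl : IsClosed (conjExp (M i) V : Set (G K)) := by
    have := hF'.isClosedEmbedding_subtypeVal.isClosedMap _ hVcl'
    convert this
    ext f
    exact ⟨fun hf => ⟨⟨f, hVF hf⟩, hf, rfl⟩, by rintro ⟨f, hf, rfl⟩; exact hf⟩
  have hTV : T ≤ conjExp (M i) V := by
    have hT' : IsPreconnected (Subtype.val ⁻¹' (T : Set (G K)) : Set F') := by
      refine IsInducing.subtypeVal.isPreconnected_image.1 ?_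
      convert hT using 1
      ext f
      exact ⟨by rintro ⟨f, hf, rfl⟩; exact hf, fun hf => ⟨⟨f, hTF hf⟩, hf, rfl⟩⟩
    have := hT'.subset_isClopen ⟨hVcl', hV⟩
      ⟨1, one_mem T, one_mem _⟩
    exact fun t ht => this (a := ⟨t, hTF ht⟩) ht
  -- the orbit of the open subgroup is closed and contains the orbit of `T`
  refine ⟨conjExp (M i) V, π g, isTorus_conjExp hVcl, Set.Subset.antisymm ?_ ?_⟩
  · refine closure_minimal ?_ (isClosed_orbit_of_isOpen_subgroupOf hF' hV hVF (hSF ▸ hScl))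
    rintro _ ⟨t, rfl⟩
    exact ⟨⟨t, hTV t.2⟩, rfl⟩
  · rintro _ ⟨f, rfl⟩
    exact hF'S f (hVF f.2) _ hgS

end

/-! ### Ergodic measures on orbits -/

section

/-- Let an abelian locally compact group `E` act on `X` through a surjection onto `T`. The image of
the Haar measure of `E` modulo the stabilizer of `x` under the orbit map is an invariant ergodic
measure, and its support is the closure of the orbit of `x`. -/
theorem exists_ergodic_support_eq_closure_orbit {E : Type*} [AddCommGroup E] [TopologicalSpace E]
    [IsTopologicalAddGroup E] [LocallyCompactSpace E] [SecondCountableTopology E]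
    {X : Type*} [TopologicalSpace X] [T2Space X] [MeasurableSpace X] [BorelSpace X]
    {T : Type*} [Group T] [MulAction T X] [ContinuousConstSMul T X] {ψ : E → T}
    (hadd : ∀ a b, ψ (a + b) = ψ a * ψ b) (hψ : Function.Surjective ψ) {x : X}
    (hc : Continuous fun s => ψ s • x) :
    ∃ μ : Measure X, SigmaFinite μ ∧ SMulInvariantMeasure T X μ ∧ ErgodicSMul T X μ ∧
      μ.support = closure (MulAction.orbit T x) := by
  have hψ0 : ψ 0 = 1 := by
    have := hadd 0 0
    rw [add_zero] at this
    exact left_eq_mul.1 this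
  let A : AddSubgroup E :=
    { carrier := {s | ψ s • x = x}
      add_mem' := fun {a b} (ha : ψ a • x = x) (hb : ψ b • x = x) => by
        change ψ (a + b) • x = x
        rw [hadd, mul_smul, hb, ha]
      zero_mem' := by
        change ψ 0 • x = x
        rw [hψ0, one_smul]
      neg_mem' := fun {a} (ha : ψ a • x = x) => by
        change ψ (-a) • x = x
        conv_lhs => rw [← ha, smul_smul, ← hadd, neg_add_cancel, hψ0, one_smul] }
  have hA : IsClosed (A : Set E) := isClosed_eq hc continuous_const
  borelize (E ⧸ A)
  have hker : ∀ a b : E, (a : E ⧸ A) = b ↔ ψ a • x = ψ b • x := fun a b => by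
    rw [QuotientAddGroup.eq]
    change ψ (-a + b) • x = x ↔ _
    have h1 : ψ b • x = ψ a • ψ (-a + b) • x := by
      rw [smul_smul, ← hadd, add_neg_cancel_left]
    rw [h1]
    exact ⟨fun h => by rw [h], fun h => (MulAction.injective (ψ a) h).symm⟩
  let j : E ⧸ A → X := Quotient.lift (fun s => ψ s • x) fun a b h =>
    (hker a b).1 (Quotient.sound h)
  have hj : ∀ s : E, j s = ψ s • x := fun s => rfl
  have hjc : Continuous j := hc.quotient_lift _
  have hjm : Measurable j := hjc.measurable
  have hjinj : Function.Injective j := by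
    rintro ⟨a⟩ ⟨b⟩ h
    exact (hker a b).2 h
  have hjadd : ∀ (a : E) (q : E ⧸ A), ψ a • j q = j (a + q) := by
    rintro a ⟨b⟩
    change ψ a • ψ b • x = ψ (a + b) • x
    rw [hadd, mul_smul]
  have hrange : Set.range j = MulAction.orbit T x := by
    ext y
    constructor
    · rintro ⟨⟨s⟩, rfl⟩
      exact ⟨ψ s, rfl⟩
    · rintro ⟨t, rfl⟩
      obtain ⟨s, rfl⟩ := hψ t
      exact ⟨s, rfl⟩
  let ν : Measure (E ⧸ A) := Measure.addHaar
  have hsmul : ∀ t : T, Measurable fun y : X => t • y := fun t =>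
    (continuous_const_smul t).measurable
  have hinv : SMulInvariantMeasure T X (ν.map j) := ⟨fun t s hs => by
    obtain ⟨a, rfl⟩ := hψ t
    rw [Measure.map_apply hjm hs, Measure.map_apply hjm (hsmul _ hs)]
    have : j ⁻¹' ((fun y => ψ a • y) ⁻¹' s) = (fun q => (a : E ⧸ A) + q) ⁻¹' (j ⁻¹' s) := by
      ext q
      simp only [Set.mem_preimage, hjadd]
    rw [this, measure_preimage_add]⟩
  refine ⟨ν.map j, ⟨⟨?_⟩⟩, hinv, ⟨fun {s} hs h => ?_⟩, ?_⟩
  · -- the images of compact sets have finite measure, and the complement of the orbit is null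
    let C := CompactExhaustion.choice (E ⧸ A)
    have hCm : ∀ n, MeasurableSet (j '' C n) := fun n =>
      ((C.isCompact n).image hjc).isClosed.measurableSet
    have hrm : MeasurableSet (Set.range j) := by
      rw [← Set.image_univ, ← C.iUnion_eq, Set.image_iUnion]
      exact MeasurableSet.iUnion hCm
    refine ⟨fun n => j '' C n ∪ (Set.range j)ᶜ, fun _ => trivial, fun n => ?_, ?_⟩
    · rw [Measure.map_apply hjm ((hCm n).union hrm.compl), Set.preimage_union,
        hjinj.preimage_image, Set.preimage_compl, Set.preimage_range, Set.compl_univ,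
        Set.union_empty]
      exact (C.isCompact n).measure_lt_top
    · rw [← Set.iUnion_union, ← Set.image_iUnion, C.iUnion_eq, Set.image_univ, Set.union_compl_self]
  · have h1 : ∀ q : E ⧸ A, (fun p => q +ᵥ p) ⁻¹' (j ⁻¹' s) =ᵐ[ν] j ⁻¹' s := by
      rintro ⟨a⟩
      have h2 := ae_of_ae_map hjm.aemeasurable (h (ψ a))
      filter_upwards [h2] with q hq
      change (ψ a • j q ∈ s) = (j q ∈ s) at hq
      rw [hjadd] at hq
      exact hq
    -- a group acts ergodically on itself
    have h2 := ErgodicVAdd.aeconst_of_forall_preimage_vadd_ae_eq (hjm hs) h1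
    rw [eventuallyConst_set] at h2 ⊢
    exact h2.imp (ae_map_iff hjm.aemeasurable hs).2 (ae_map_iff hjm.aemeasurable hs.compl).2
  · rw [← hrange]
    refine Set.Subset.antisymm ?_ fun y hy => (Measure.mem_support_iff_forall y).2 fun U hU => ?_
    · refine Measure.support_subset_of_isClosed isClosed_closure ?_
      refine (ae_map_iff hjm.aemeasurable isClosed_closure.measurableSet).2
        (ae_of_all _ fun q => ?_)
      exact subset_closure ⟨q, rfl⟩
    · obtain ⟨O, hOU, hO, hyO⟩ := mem_nhds_iff.1 hU
      obtain ⟨_, hqO, q, rfl⟩ := mem_closure_iff.1 hy O hO hyO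
      refine lt_of_lt_of_le ?_ (measure_mono hOU)
      rw [Measure.map_apply hjm hO.measurableSet]
      exact (hO.preimage hjc).measure_pos ν ⟨q, hqO⟩

end

/-! ### Local divergence and rational rows -/

section

variable {K : Type*} [Field K] [NumberField K]

/-- A divergent orbit of `D_{v,ℝ}` or of a larger group makes the rows of `g_v` rational. -/
theorem nonempty_rationalRows {H : Subgroup (G K)} {v : InfinitePlace K} (hH : DR {v} ≤ H)
    {g : G K} (hg : IsDivergent H (π g)) : Nonempty (RationalRows g v) := by
  have h : ∀ i, ∃ r : Fin 2 → 𝓞 K, r ≠ 0 ∧ ∃ c : v.Completion, c ≠ 0 ∧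
      ∀ k, g v i k = c * emb v (r k) := fun i => by
    obtain ⟨w, hw, h⟩ := exists_vec_eq_zero_of_isDivergent hH hg i
    exact exists_row_eq_smul hw h
  choose r hr c hc h using h
  exact ⟨⟨r, c, hr, hc, h⟩⟩

theorem mem_diagSubgroup_of_mem_D {I : Finset (InfinitePlace K)} {t : G K} (ht : t ∈ D I) :
    t ∈ diagSubgroup K := by
  obtain ⟨s, -, rfl⟩ : t ∈ diagExp '' (lieD I : Set (InfinitePlace K → ℂ)) := coe_D I ▸ ht
  exact fun v => ⟨rfl, rfl⟩

end

end HilbertModular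

open HilbertModular

/-- `𝒟` is one of the two families `I ↦ D_I`, `I ↦ D_{I,ℝ}`, and `T = 𝒟 I`; the orbit `T π(g)` is
locally divergent if the orbits of the factors `𝒟 {v}`, `v ∈ I`, are divergent. -/
theorem theorem2 {K : Type*} [Field K] [NumberField K]
    (I : Finset (InfinitePlace K)) (hI : I.card = 2)
    (𝒟 : Finset (InfinitePlace K) → Subgroup (HilbertModular.G K))
    (h𝒟 : 𝒟 = HilbertModular.D ∨ 𝒟 = HilbertModular.DR)
    (g : HilbertModular.G K)
    (hdiv : ∀ v ∈ I, HilbertModular.IsDivergent (𝒟 {v}) (HilbertModular.π g))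
    (htorus : ¬ HilbertModular.IsTorusOrbit
      (closure (MulAction.orbit (𝒟 I) (HilbertModular.π g)))) :
    (∃ μ : Measure (HilbertModular.Space K),
      SigmaFinite μ ∧
      SMulInvariantMeasure (𝒟 I) (HilbertModular.Space K) μ ∧
      ErgodicSMul (𝒟 I) (HilbertModular.Space K) μ ∧
      ¬ HilbertModular.IsAlgebraic I μ ∧
      closure (MulAction.orbit (𝒟 I) (HilbertModular.π g)) = μ.support) ∧
    ¬ HilbertModular.IsHomogeneous I
      (closure (MulAction.orbit (𝒟 I) (HilbertModular.π g))) := by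
  classical
  have hDR : ∀ J, DR J ≤ 𝒟 J := by
    rcases h𝒟 with rfl | rfl
    exacts [DR_le_D, fun _ => le_rfl]
  have hD : ∀ J, 𝒟 J ≤ D J := by
    rcases h𝒟 with rfl | rfl
    exacts [fun _ => le_rfl, DR_le_D]
  obtain ⟨V, hV⟩ : ∃ V : Submodule ℝ (InfinitePlace K → ℂ), (𝒟 I : Set (G K)) = diagExp '' V := by
    rcases h𝒟 with rfl | rfl
    exacts [⟨_, coe_D I⟩, ⟨_, coe_DR I⟩]
  obtain ⟨v₁, v₂, hv, hIv⟩ := Finset.card_eq_two.1 hI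
  obtain ⟨ρ₁⟩ := nonempty_rationalRows (hDR {v₁}) (hdiv v₁ (by simp [hIv]))
  obtain ⟨ρ₂⟩ := nonempty_rationalRows (hDR {v₂}) (hdiv v₂ (by simp [hIv]))
  obtain ⟨M, h, hcov⟩ := exists_closure_orbit_subset hv ρ₁ ρ₂ (T := 𝒟 I)
    fun t ht => ⟨mem_diagSubgroup_of_mem_D (hD _ ht),
      fun v h₁ h₂ => (hD _ ht v).2 (by simp [hIv, h₁, h₂])⟩
  have hconn : IsPreconnected (𝒟 I : Set (G K)) := by
    rw [hV]
    exact V.convex.isPreconnected.image _ continuous_diagExp.continuousOn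
  have hhom : ¬ IsHomogeneous I (closure (MulAction.orbit (𝒟 I) (π g))) := by
    rintro ⟨F, y, -, -, hF⟩
    exact htorus (isTorusOrbit_closure_of_eq_orbit hconn hcov hF)
  refine ⟨?_, hhom⟩
  have hmem : ∀ s : V, diagExp (s : InfinitePlace K → ℂ) ∈ 𝒟 I := fun s => by
    rw [← SetLike.mem_coe, hV]
    exact ⟨s, s.2, rfl⟩
  have : ContinuousConstSMul (𝒟 I) (Space K) := ⟨fun t => continuous_const_smul (t : G K)⟩
  obtain ⟨μ, hσ, hinv, herg, hsupp⟩ := exists_ergodic_support_eq_closure_orbit (E := V)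
    (T := 𝒟 I) (ψ := fun s => ⟨diagExp (s : InfinitePlace K → ℂ), hmem s⟩) (x := π g)
    (fun a b => Subtype.ext (diagExp_add _ _))
    (fun t => by
      have ht : (t : G K) ∈ diagExp '' (V : Set (InfinitePlace K → ℂ)) := hV ▸ t.2
      obtain ⟨s, hs, hst⟩ := ht
      exact ⟨⟨s, hs⟩, Subtype.ext hst⟩)
    ((continuous_diagExp.comp continuous_subtype_val).smul continuous_const)
  refine ⟨μ, hσ, hinv, herg, ?_, hsupp.symm⟩
  rintro ⟨F, y, hF, hRF, -, hsF⟩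
  exact hhom ⟨F, y, hF, hRF, hsupp ▸ hsF⟩
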